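/- Notation. Let $(\Omega,\mu)$ be a probability space and let $F$ be a class of real-valued measurable functions on $\Omega$. For $p\ge 1$ and a measurable $f:\Omega\to\mathbb R$ put $$\|f\|_{(p)}=\sup_{1\le r\le p}\frac{\|f\|_{L_r(\mu)}}{\sqrt r}\in[0,\infty].$$ An admissible sequence of $F$ is a sequence $(F_s)_{s\ge 0}$ of nonempty subsets of $F$ with $|F_0|=1$ and $|F_s|\le 2^{2^s}$ for $s\ge1$. For $u\ge 1$ and an integer $s_0\ge 0$ set $$\tilde\Lambda_{s_0,u}(F)=\inf\Big(\sup_{f\in F}\sum_{s\ge s_0}2^{s/2}\|f-\pi_sf\|_{(u^22^s)}+2^{s_0/2}\sup_{f\in F}\|\pi_{s_0}f\|_{(u^22^{s_0})}\Big)\in[0,\infty],$$ where the infimum is over all admissible sequences $(F_s)_{s\ge0}$ of $F$, and $\pi_sf$ is a nearest point to $f$ in $F_s$ with respect to $\|\cdot\|_{(u^22^s)}$. (The infimum of the empty set is $\infty$, and $0\cdot\infty=0$.) Theorem. For every $q>2$ there are constants $c_0,c_1,c_2,c_3>0$ that depend only on $q$, for which the following holds. Let $X$ be distributed according to $\mu$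 and let $\xi\in L_q$ be a real random variable on the same probability space as $X$ ($\xi$ need not be independent of $X$). Let $N\ge 2$ and let $(\xi_1,X_1),\dots,(\xi_N,X_N)$ be independent copies of the pair $(\xi,X)$. Let $s_0\ge0$ be an integer and let $w,u>c_0$. Then for every countable $H\subset F$, with probability at least $$1-c_1w^{-q}N^{-((q/2)-1)}\log^qN-2\exp(-c_2u^22^{s_0}),$$ one has $$\sup_{f\in H}\left|\frac1{\sqrt N}\sum_{i=1}^N\big(\xi_if(X_i)-\mathbb E\,\xi f(X)\big)\right|\le c_3\,w\,u\,\|\xi\|_{L_q}\,\tilde\Lambda_{s_0,u}(F).$$ In particular, if $F$ is countable, this holds with $H=F$. -/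

import Mathlib

open MeasureTheory ProbabilityTheory
open scoped ENNReal

noncomputable section

/-- The graded norm `‖Z‖_{(p)} = sup_{1 ≤ r ≤ p} ‖Z‖_{L_r(μ)} / √r`, with values in `[0, ∞]`;
the supremum runs over all real `r ∈ [1, p]`. -/
def gradedNorm {Ω : Type*} [MeasurableSpace Ω] (μ : Measure Ω) (p : ℝ) (Z : Ω → ℝ) : ℝ≥0∞ :=
  ⨆ r ∈ Set.Icc (1 : ℝ) p, eLpNorm Z (ENNReal.ofReal r) μ / ENNReal.ofReal (√r)

/-- An admissible sequence of a class `F`: nonempty finite subsets `F_s ⊆ F` (not necessarily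
nested) with `|F_0| = 1` and `|F_s| ≤ 2^{2^s}` for `s ≥ 1`. -/
structure AdmissibleSeq {Ω : Type*} (F : Set (Ω → ℝ)) where
  level : ℕ → Finset (Ω → ℝ)
  level_subset : ∀ s, (level s : Set (Ω → ℝ)) ⊆ F
  level_nonempty : ∀ s, (level s).Nonempty
  card_zero : (level 0).card = 1
  card_le : ∀ s, 1 ≤ s → (level s).card ≤ 2 ^ 2 ^ s

/-- `π s f` is a nearest point to `f` in the `s`-th level of the admissible sequence `A`, with
respect to the norm `‖ ‖_{(u² 2^s)}`, for every `s` and every `f ∈ F`. -/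
def AdmissibleSeq.IsNearestPointMap {Ω : Type*} [MeasurableSpace Ω] {F : Set (Ω → ℝ)}
    (A : AdmissibleSeq F) (μ : Measure Ω) (u : ℝ) (π : ℕ → (Ω → ℝ) → (Ω → ℝ)) : Prop :=
  ∀ s, ∀ f ∈ F, π s f ∈ A.level s ∧
    ∀ g ∈ A.level s,
      gradedNorm μ (u ^ 2 * 2 ^ s) (f - π s f) ≤ gradedNorm μ (u ^ 2 * 2 ^ s) (f - g)

/-- `sup_{f ∈ F} ∑_{s ≥ s₀} 2^{s/2} ‖f - π_s f‖_{(u² 2^s)}` for given maps `π_s`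
(the sum is written with `s = s₀ + k`, `k ≥ 0`). -/
def chainingSum {Ω : Type*} [MeasurableSpace Ω] (μ : Measure Ω) (s₀ : ℕ) (u : ℝ)
    (F : Set (Ω → ℝ)) (π : ℕ → (Ω → ℝ) → (Ω → ℝ)) : ℝ≥0∞ :=
  ⨆ f ∈ F, ∑' k : ℕ, (2 : ℝ≥0∞) ^ (((s₀ + k : ℕ) : ℝ) / 2) *
    gradedNorm μ (u ^ 2 * 2 ^ (s₀ + k)) (f - π (s₀ + k) f)

/-- `2^{s₀/2} sup_{f ∈ F} ‖π_{s₀} f‖_{(u² 2^{s₀})}`, the contribution of the starting points. -/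
def startingTerm {Ω : Type*} [MeasurableSpace Ω] (μ : Measure Ω) (s₀ : ℕ) (u : ℝ)
    (F : Set (Ω → ℝ)) (π : ℕ → (Ω → ℝ) → (Ω → ℝ)) : ℝ≥0∞ :=
  (2 : ℝ≥0∞) ^ ((s₀ : ℝ) / 2) * ⨆ f ∈ F, gradedNorm μ (u ^ 2 * 2 ^ s₀) (π s₀ f)

/-- The complexity parameter `Λ̃_{s₀,u}(F)`: the infimum, over all admissible sequences of `F` and
their nearest point maps, of
`sup_{f ∈ F} ∑_{s ≥ s₀} 2^{s/2} ‖f - π_s f‖_{(u² 2^s)} + 2^{s₀/2} sup_{f ∈ F} ‖π_{s₀} f‖_{(u² 2^{s₀})}`,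
where both terms are computed with the same maps. It takes values in `[0, ∞]`. -/
def lambdaTilde {Ω : Type*} [MeasurableSpace Ω] (μ : Measure Ω) (s₀ : ℕ) (u : ℝ)
    (F : Set (Ω → ℝ)) : ℝ≥0∞ :=
  ⨅ (A : AdmissibleSeq F) (π : ℕ → (Ω → ℝ) → (Ω → ℝ)) (_ : A.IsNearestPointMap μ u π),
    (chainingSum μ s₀ u F π + startingTerm μ s₀ u F π)

end

/-! ### Exponential-moment tail bounds for i.i.d. sums. -/

section PiTails

variable {E : Type*} [MeasurableSpace E] {ν : Measure E} [IsProbabilityMeasure ν] {N : ℕ}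

/-! Divide ξ by w‖ξ‖_{L_q}, giving a multiplier η with 𝔼|η|^q ≤ w^{-q}. Its heavy tail is paid for
once, by an event on the multipliers alone (`multiplierEvent`): every |η_i| is at most √N, boundedly
many exceed N^{1/b}, and the moderately large ones satisfy ∑|η_i|^a = O(N), where 2 < a < b < q. The
event fails with probability O(w^{-q} N^{-(q/2-1)}) (`exists_measure_compl_multiplierEvent_le`). It
does not involve f, so no union bound multiplies this cost.

On that event each single function has a subgaussian-type deviation. Let ‖z‖_{L_r} ≤ √r for 1 ≤ r ≤
p and put σ = √(N/p), so that √(Np) = σp. Truncate η at T = σ^{1-1/M} and z at K = σ^{1/M}. The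
truncated product is bounded by σ and has bounded second moment, so Bernstein's inequality gives
deviation O(σp) outside probability 2e^{-κp}. The remainder is at most σ^{-1}(1+|η|^a) + σ z²
1_{|z|>K}. The event controls the sum of the first part; the sum of the second is handled through
truncated exponential series, which need only moments of order at most p
(`exists_measure_pi_sum_largeSq_ge_le`). The few indices with very large η_i are bounded one by one,
using |η_i| ≤ √N. This yields `exists_measure_pi_multiplierEvent_inter_le`. Independence of ξ and X
plays no role: mixed moments are split by Young's inequality.

Generic chaining then concludes (`exists_measure_iSup_multiplierSum_gt_le`). With p = u² 2^s and κ =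
3, the tail 5e^{-3p} beats the at most 2^{3·2^s} links between levels s and s+1, and the deviations
add up to a multiple of √N·w·u‖ξ‖_{L_q}Λ̃. The resulting failure probability carries no logarithm;
the factor log^q N enters only at the end, by bounding it below by log^q 2. -/

theorem lintegral_pi_prod_eq_pow {G : E → ℝ≥0∞} (hG : Measurable G) :
    ∫⁻ y, ∏ i : Fin N, G (y i) ∂(Measure.pi fun _ : Fin N => ν) = (∫⁻ x, G x ∂ν) ^ N := by
  have hind : iIndepFun (fun (i : Fin N) (y : Fin N → E) => G (y i))
      (Measure.pi fun _ : Fin N => ν) :=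
    iIndepFun_pi (X := fun _ => G) (fun _ => hG.aemeasurable)
  rw [lintegral_prod_eq_prod_lintegral_of_indepFun _ _ hind
    (fun i => hG.comp (measurable_pi_apply i))]
  have h : ∀ i : Fin N, ∫⁻ y, G (y i) ∂(Measure.pi fun _ : Fin N => ν) = ∫⁻ x, G x ∂ν := fun i =>
    (measurePreserving_eval (fun _ : Fin N => ν) i).lintegral_comp hG
  simp [h]

/-- Markov's inequality for a product of i.i.d. nonnegative factors. -/
theorem measure_pi_le_of_le_prod {G : E → ℝ} (hG : Measurable G) (hG0 : ∀ x, 0 ≤ G x) {δ c : ℝ}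
    (hδ : 0 ≤ δ) (hc : 0 < c) (hint : ∫⁻ x, ENNReal.ofReal (G x) ∂ν ≤ ENNReal.ofReal (1 + δ))
    {S : Set (Fin N → E)} (hS : ∀ y ∈ S, c ≤ ∏ i, G (y i)) :
    (Measure.pi fun _ : Fin N => ν) S ≤ ENNReal.ofReal (Real.exp (N * δ) / c) := by
  have hGm : Measurable fun x => ENNReal.ofReal (G x) := hG.ennreal_ofReal
  have hm : Measurable fun y : Fin N → E => ∏ i : Fin N, ENNReal.ofReal (G (y i)) :=
    Finset.measurable_prod _ fun i _ => hGm.comp (measurable_pi_apply i)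
  have hsub : S ⊆ {y : Fin N → E | ENNReal.ofReal c ≤ ∏ i : Fin N, ENNReal.ofReal (G (y i))} := by
    intro y hy
    rw [Set.mem_ofPred_eq, ← ENNReal.ofReal_prod_of_nonneg fun i _ => hG0 _]
    exact ENNReal.ofReal_le_ofReal (hS y hy)
  refine (measure_mono hsub).trans ?_
  refine (meas_ge_le_lintegral_div hm.aemeasurable (by simpa using hc) (by simp)).trans ?_
  rw [lintegral_pi_prod_eq_pow hGm, ENNReal.ofReal_div_of_pos hc]
  gcongr
  calc (∫⁻ x, ENNReal.ofReal (G x) ∂ν) ^ N ≤ (ENNReal.ofReal (1 + δ)) ^ N := by gcongr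
    _ = ENNReal.ofReal ((1 + δ) ^ N) := (ENNReal.ofReal_pow (by positivity) N).symm
    _ ≤ ENNReal.ofReal (Real.exp (N * δ)) := by
      apply ENNReal.ofReal_le_ofReal
      rw [Real.exp_nat_mul]
      gcongr
      linarith [Real.add_one_le_exp δ]

/-- Bernstein's inequality with the parameter `lam` left free: e^x ≤ 1 + x + x² on [-1, 1], and the
linear term vanishes after centering. -/
theorem measure_pi_sum_centered_ge_le {φ : E → ℝ} (hφ : Measurable φ) {B V lam t : ℝ}
    (hB : ∀ x, |φ x| ≤ B) (hV : 0 ≤ V) (hlam : 0 ≤ lam) (hlB : 2 * lam * B ≤ 1)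
    (hint : ∫⁻ x, ENNReal.ofReal (φ x ^ 2) ∂ν ≤ ENNReal.ofReal V) :
    (Measure.pi fun _ : Fin N => ν) {y | t ≤ ∑ i, (φ (y i) - ∫ x, φ x ∂ν)}
      ≤ ENNReal.ofReal (Real.exp (N * (lam ^ 2 * V) - lam * t)) := by
  set m := ∫ x, φ x ∂ν with hm
  have hφi : Integrable φ ν := Integrable.of_bound hφ.aestronglyMeasurable B (.of_forall hB)
  have hmB : |m| ≤ B := by
    have := norm_integral_le_of_norm_le_const (μ := ν) (.of_forall hB : ∀ᵐ x ∂ν, ‖φ x‖ ≤ B)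
    simpa using this
  have hφ2 : Integrable (fun x => φ x ^ 2) ν := by
    refine Integrable.of_bound (hφ.pow_const 2).aestronglyMeasurable (B ^ 2) (.of_forall fun x => ?_)
    rw [Real.norm_eq_abs, abs_pow]
    gcongr
    exact hB x
  have hφ2V : ∫ x, φ x ^ 2 ∂ν ≤ V := by
    rw [← ofReal_integral_eq_lintegral_ofReal hφ2 (.of_forall fun x => sq_nonneg _)] at hint
    exact (ENNReal.ofReal_le_ofReal_iff hV).1 hint
  have hGm : Measurable fun x => Real.exp (lam * (φ x - m)) := by fun_prop
  have habs : ∀ x, |lam * (φ x - m)| ≤ 1 := fun x => by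
    rw [abs_mul, abs_of_nonneg hlam]
    have h1 : |φ x - m| ≤ 2 * B := (abs_sub _ _).trans (by linarith [hB x])
    calc lam * |φ x - m| ≤ lam * (2 * B) := by gcongr
      _ ≤ 1 := by linarith
  have hGle : ∀ x, Real.exp (lam * (φ x - m)) ≤ 1 + lam * (φ x - m) + (lam * (φ x - m)) ^ 2 :=
    fun x => by linarith [(abs_le.1 (Real.abs_exp_sub_one_sub_id_le (habs x))).2]
  have hqi : Integrable (fun x => 1 + lam * (φ x - m) + (lam * (φ x - m)) ^ 2) ν := by
    have : (fun x => 1 + lam * (φ x - m) + (lam * (φ x - m)) ^ 2)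
      = fun x => (1 - lam * m + lam ^ 2 * m ^ 2) + (lam - 2 * lam ^ 2 * m) * φ x
        + lam ^ 2 * φ x ^ 2 := by ext x; ring
    rw [this]
    exact ((integrable_const _).add (hφi.const_mul _)).add (hφ2.const_mul _)
  have hint2 : ∫ x, (1 + lam * (φ x - m) + (lam * (φ x - m)) ^ 2) ∂ν ≤ 1 + lam ^ 2 * V := by
    have h1 : (fun x => 1 + lam * (φ x - m) + (lam * (φ x - m)) ^ 2)
      = fun x => (1 - lam * m + lam ^ 2 * m ^ 2) + (lam - 2 * lam ^ 2 * m) * φ x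
        + lam ^ 2 * φ x ^ 2 := by ext x; ring
    have h2 : Integrable (fun x => (1 - lam * m + lam ^ 2 * m ^ 2)
        + (lam - 2 * lam ^ 2 * m) * φ x) ν := (integrable_const _).add (hφi.const_mul _)
    rw [h1, integral_add h2 (hφ2.const_mul _),
      integral_add (integrable_const _) (hφi.const_mul _), integral_const_mul, integral_const_mul,
      ← hm]
    simp only [integral_const, probReal_univ, smul_eq_mul, one_mul]
    nlinarith [mul_le_mul_of_nonneg_left hφ2V (sq_nonneg lam), sq_nonneg (lam * m)]
  have key := measure_pi_le_of_le_prod (ν := ν) (N := N) hGm (fun x => (Real.exp_pos _).le)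
    (δ := lam ^ 2 * V) (c := Real.exp (lam * t)) (by positivity) (Real.exp_pos _)
    (by
      calc ∫⁻ x, ENNReal.ofReal (Real.exp (lam * (φ x - m))) ∂ν
          ≤ ∫⁻ x, ENNReal.ofReal (1 + lam * (φ x - m) + (lam * (φ x - m)) ^ 2) ∂ν :=
            lintegral_mono fun x => ENNReal.ofReal_le_ofReal (hGle x)
        _ = ENNReal.ofReal (∫ x, (1 + lam * (φ x - m) + (lam * (φ x - m)) ^ 2) ∂ν) :=
            (ofReal_integral_eq_lintegral_ofReal hqi
              (.of_forall fun x => (Real.exp_pos _).le.trans (hGle x))).symm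
        _ ≤ _ := ENNReal.ofReal_le_ofReal hint2)
    (S := {y | t ≤ ∑ i, (φ (y i) - m)})
    (by
      intro y hy
      rw [← Real.exp_sum, ← Finset.mul_sum]
      exact Real.exp_le_exp.2 (mul_le_mul_of_nonneg_left hy hlam))
  rwa [← Real.exp_sub] at key

theorem measure_pi_abs_sum_centered_ge_le {φ : E → ℝ} (hφ : Measurable φ) {B V lam t : ℝ}
    (hB : ∀ x, |φ x| ≤ B) (hV : 0 ≤ V) (hlam : 0 ≤ lam) (hlB : 2 * lam * B ≤ 1)
    (hint : ∫⁻ x, ENNReal.ofReal (φ x ^ 2) ∂ν ≤ ENNReal.ofReal V) :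
    (Measure.pi fun _ : Fin N => ν) {y | t ≤ |∑ i, (φ (y i) - ∫ x, φ x ∂ν)|}
      ≤ ENNReal.ofReal (2 * Real.exp (N * (lam ^ 2 * V) - lam * t)) := by
  have h1 := measure_pi_sum_centered_ge_le (ν := ν) (N := N) (t := t) hφ hB hV hlam hlB hint
  have h2 := measure_pi_sum_centered_ge_le (ν := ν) (N := N) (t := t) (φ := fun x => -φ x) hφ.neg
    (by simpa using hB) hV hlam hlB (by simpa using hint)
  have hsub : {y : Fin N → E | t ≤ |∑ i, (φ (y i) - ∫ x, φ x ∂ν)|} ⊆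
      {y | t ≤ ∑ i, (φ (y i) - ∫ x, φ x ∂ν)} ∪ {y | t ≤ ∑ i, (-φ (y i) - ∫ x, -φ x ∂ν)} := by
    intro y hy
    have hy' : t ≤ |∑ i, (φ (y i) - ∫ x, φ x ∂ν)| := hy
    rcases le_abs.1 hy' with h | h
    · exact Or.inl h
    · refine Or.inr (h.trans (le_of_eq ?_))
      rw [integral_neg, ← Finset.sum_neg_distrib]
      exact Finset.sum_congr rfl fun i _ => by ring
  refine (measure_mono hsub).trans ((measure_union_le _ _).trans ((add_le_add h1 h2).trans ?_))
  rw [← ENNReal.ofReal_add (by positivity) (by positivity), two_mul]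

/-- Bennett-type bound for sums of i.i.d. variables with values in `[0, B]`. -/
theorem measure_pi_sum_ge_le {V : E → ℝ} (hVm : Measurable V) {B v L t : ℝ} (hB : 0 < B)
    (hV0 : ∀ x, 0 ≤ V x) (hVB : ∀ x, V x ≤ B) (hv : 0 ≤ v) (hL : 0 ≤ L)
    (hint : ∫⁻ x, ENNReal.ofReal (V x) ∂ν ≤ ENNReal.ofReal v) :
    (Measure.pi fun _ : Fin N => ν) {y | t ≤ ∑ i, V (y i)}
      ≤ ENNReal.ofReal (Real.exp (N * (v / B * Real.exp L) - L * t / B)) := by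
  -- The exponential lies below its chord on [0, L], evaluated at the convex weight V/B.
  have hGle : ∀ x, Real.exp (L * V x / B) ≤ 1 + V x * (Real.exp L / B) := fun x => by
    have h0 : 0 ≤ V x / B := div_nonneg (hV0 x) hB.le
    have h1 : V x / B ≤ 1 := (div_le_one hB).2 (hVB x)
    have := convexOn_exp.2 (Set.mem_univ (0 : ℝ)) (Set.mem_univ L) (sub_nonneg.2 h1) h0 (by ring)
    simp only [smul_eq_mul, mul_zero, zero_add, Real.exp_zero, mul_one] at this
    calc Real.exp (L * V x / B) = Real.exp (V x / B * L) := by ring_nf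
      _ ≤ _ := this
      _ ≤ 1 + V x / B * Real.exp L := by linarith
      _ = _ := by ring
  have key := measure_pi_le_of_le_prod (ν := ν) (N := N) (G := fun x => Real.exp (L * V x / B))
    (by fun_prop) (fun x => (Real.exp_pos _).le)
    (δ := v / B * Real.exp L) (c := Real.exp (L * t / B)) (by positivity) (Real.exp_pos _)
    (by
      calc ∫⁻ x, ENNReal.ofReal (Real.exp (L * V x / B)) ∂ν
          ≤ ∫⁻ x, (1 + ENNReal.ofReal (V x) * ENNReal.ofReal (Real.exp L / B)) ∂ν := by
            refine lintegral_mono fun x => ?_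
            rw [← ENNReal.ofReal_mul (hV0 x), ← ENNReal.ofReal_one,
              ← ENNReal.ofReal_add zero_le_one (mul_nonneg (hV0 x) (by positivity))]
            exact ENNReal.ofReal_le_ofReal (hGle x)
        _ = 1 + (∫⁻ x, ENNReal.ofReal (V x) ∂ν) * ENNReal.ofReal (Real.exp L / B) := by
            rw [lintegral_add_left measurable_const, lintegral_mul_const _ hVm.ennreal_ofReal]
            simp
        _ ≤ 1 + ENNReal.ofReal v * ENNReal.ofReal (Real.exp L / B) := by gcongr
        _ = _ := by
            rw [← ENNReal.ofReal_mul hv, ← ENNReal.ofReal_one,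
              ← ENNReal.ofReal_add zero_le_one (by positivity)]
            congr 1; ring)
    (S := {y | t ≤ ∑ i, V (y i)})
    (by
      intro y hy
      rw [← Real.exp_sum, ← Finset.sum_div, ← Finset.mul_sum]
      gcongr
      exact hy)
  rwa [← Real.exp_sub] at key

/-- The truncated exponential series `∑_{j ≤ k} x ^ j / j!`. -/
noncomputable def truncExp (k : ℕ) (x : ℝ) : ℝ := ∑ j ∈ Finset.range (k + 1), x ^ j / j.factorial

theorem truncExp_nonneg (k : ℕ) {x : ℝ} (hx : 0 ≤ x) : 0 ≤ truncExp k x :=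
  Finset.sum_nonneg fun j _ => by positivity

theorem truncExp_zero (k : ℕ) : truncExp k 0 = 1 := by
  simp [truncExp, Finset.sum_range_succ']

theorem pow_div_factorial_le_truncExp (k : ℕ) {x : ℝ} (hx : 0 ≤ x) :
    x ^ k / k.factorial ≤ truncExp k x :=
  Finset.single_le_sum (f := fun j : ℕ => x ^ j / (j.factorial : ℝ))
    (fun j _ => by positivity) (Finset.self_mem_range_succ k)

/-- The left side expands over pairs with a + b ≤ k, the right side over the larger square a, b ≤ k,
and all terms are nonnegative. This replaces e^{x+y} = e^x e^y when only finitely many moments are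
available. -/
theorem truncExp_add_le (k : ℕ) {x y : ℝ} (hx : 0 ≤ x) (hy : 0 ≤ y) :
    truncExp k (x + y) ≤ truncExp k x * truncExp k y := by
  have h1 : ∀ j : ℕ, (x + y) ^ j / (j.factorial : ℝ) = ∑ a ∈ Finset.HasAntidiagonal.antidiagonal j,
      (x ^ a.1 / (a.1.factorial : ℝ)) * (y ^ a.2 / (a.2.factorial : ℝ)) := by
    intro j
    rw [(Commute.all x y).add_pow', Finset.sum_div]
    refine Finset.sum_congr rfl fun a ha => ?_
    rw [Finset.HasAntidiagonal.mem_antidiagonal] at ha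
    subst ha
    have h2 : (((a.1 + a.2).choose a.1 : ℕ) : ℝ) * a.1.factorial * a.2.factorial
      = (a.1 + a.2).factorial := by
      rw [Nat.choose_symm_add]
      exact_mod_cast Nat.add_choose_mul_factorial_mul_factorial a.1 a.2
    rw [nsmul_eq_mul, ← h2]
    have : (((a.1 + a.2).choose a.1 : ℕ) : ℝ) ≠ 0 := by
      exact_mod_cast (Nat.choose_pos (Nat.le_add_right _ _)).ne'
    field_simp
  unfold truncExp
  simp_rw [h1]
  rw [Finset.sum_sigma', Finset.sum_mul_sum, ← Finset.sum_product']
  rw [← Finset.sum_image (s := (Finset.range (k + 1)).sigma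
      fun j => Finset.HasAntidiagonal.antidiagonal j) (g := fun a => a.2)
    (f := fun a : ℕ × ℕ => (x ^ a.1 / (a.1.factorial : ℝ)) * (y ^ a.2 / (a.2.factorial : ℝ)))]
  · refine Finset.sum_le_sum_of_subset_of_nonneg ?_ fun a _ _ => by positivity
    intro a ha
    simp only [Finset.mem_image, Finset.mem_sigma, Finset.mem_range, Finset.HasAntidiagonal.mem_antidiagonal] at ha
    obtain ⟨b, ⟨h2, h3⟩, rfl⟩ := ha
    simp only [Finset.mem_product, Finset.mem_range]
    omega
  · rintro ⟨j, a⟩ ha ⟨j', a'⟩ ha' h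
    simp only [Finset.coe_sigma, Set.mem_sigma_iff, Finset.mem_coe, Finset.HasAntidiagonal.mem_antidiagonal]
      at ha ha' h
    obtain ⟨-, rfl⟩ := ha
    obtain ⟨-, rfl⟩ := ha'
    subst h
    rfl

theorem truncExp_sum_le {ι : Type*} (k : ℕ) (s : Finset ι) {x : ι → ℝ} (hx : ∀ i, 0 ≤ x i) :
    truncExp k (∑ i ∈ s, x i) ≤ ∏ i ∈ s, truncExp k (x i) := by
  classical
  induction s using Finset.induction_on with
  | empty => simp [truncExp_zero]
  | insert i s hi ih =>
    rw [Finset.sum_insert hi, Finset.prod_insert hi]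
    exact (truncExp_add_le k (hx i) (Finset.sum_nonneg fun j _ => hx j)).trans
      (mul_le_mul_of_nonneg_left ih (truncExp_nonneg k (hx i)))

/-- Tail bound for sums of i.i.d. nonnegative variables through the truncated exponential. -/
theorem measure_pi_sum_ge_le_truncExp {W : E → ℝ} (hW : Measurable W) (hW0 : ∀ x, 0 ≤ W x)
    (k : ℕ) {δ t : ℝ} (hδ : 0 ≤ δ) (ht : 0 < t)
    (hint : ∫⁻ x, ENNReal.ofReal (truncExp k (W x)) ∂ν ≤ ENNReal.ofReal (1 + δ)) :
    (Measure.pi fun _ : Fin N => ν) {y | t ≤ ∑ i, W (y i)}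
      ≤ ENNReal.ofReal (Real.exp (N * δ) / (t ^ k / k.factorial)) := by
  refine measure_pi_le_of_le_prod (G := fun x => truncExp k (W x)) ?_
    (fun x => truncExp_nonneg k (hW0 x)) hδ (by positivity) hint ?_
  · unfold truncExp
    fun_prop
  · intro y hy
    have hy' : t ≤ ∑ i, W (y i) := hy
    calc t ^ k / k.factorial ≤ (∑ i, W (y i)) ^ k / k.factorial := by gcongr
      _ ≤ truncExp k (∑ i, W (y i)) := pow_div_factorial_le_truncExp k (ht.le.trans hy')
      _ ≤ _ := truncExp_sum_le k _ fun i => hW0 _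

/-- Union bound for i.i.d. coordinates. -/
theorem measure_pi_exists_le {A : Set E} (hA : MeasurableSet A) :
    (Measure.pi fun _ : Fin N => ν) {y | ∃ i, y i ∈ A} ≤ N * ν A := by
  have h : {y : Fin N → E | ∃ i, y i ∈ A} = ⋃ i : Fin N, (fun y => y i) ⁻¹' A := by
    ext y
    simp [Set.mem_iUnion]
  rw [h]
  refine (measure_iUnion_fintype_le _ _).trans ?_
  have h2 : ∀ i : Fin N, (Measure.pi fun _ : Fin N => ν) ((fun y => y i) ⁻¹' A) = ν A := fun i =>
    (measurePreserving_eval (fun _ : Fin N => ν) i).measure_preimage hA.nullMeasurableSet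
  simp [h2]

end PiTails

/-! ### The good event for the multipliers. -/

section Multipliers

variable {E : Type*} [MeasurableSpace E]

theorem measure_le_ofReal_div {ν : Measure E} {g : E → ℝ} (hg : Measurable g) {M t : ℝ} (ht : 0 < t)
    (hint : ∫⁻ x, ENNReal.ofReal (g x) ∂ν ≤ ENNReal.ofReal M) :
    ν {x | t ≤ g x} ≤ ENNReal.ofReal (M / t) := by
  have hsub : {x | t ≤ g x} ⊆ {x | ENNReal.ofReal t ≤ ENNReal.ofReal (g x)} :=
    fun x hx => ENNReal.ofReal_le_ofReal hx
  refine (measure_mono hsub).trans ?_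
  refine (meas_ge_le_lintegral_div hg.ennreal_ofReal.aemeasurable (by simpa using ht)
    (by simp)).trans ?_
  rw [ENNReal.ofReal_div_of_pos ht]
  gcongr

/-- The good event for the multipliers: all are at most `√N`, fewer than `k` exceed `N ^ (1 / b)`,
and the moderately large ones have controlled `a`-th power sum. -/
def multiplierEvent (N : ℕ) (a b D : ℝ) (k : ℕ) (η : E → ℝ) : Set (Fin N → E) :=
  {y | (∀ i, |η (y i)| ≤ √(N : ℝ)) ∧
    ∑ i, (if (N : ℝ) ^ (1 / b) < |η (y i)| then (1 : ℝ) else 0) < k ∧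
    ∑ i, (if 1 < |η (y i)| ∧ |η (y i)| ≤ (N : ℝ) ^ (1 / b) then |η (y i)| ^ a else 0) < D * N}

variable {ν : Measure E} [IsProbabilityMeasure ν] {N : ℕ} {η : E → ℝ} {q w : ℝ}

theorem measure_pi_exists_multiplier_gt (hq : 2 < q) (hN : 1 ≤ N) (hη : Measurable η)
    (hint : ∫⁻ x, ENNReal.ofReal (|η x| ^ q) ∂ν ≤ ENNReal.ofReal (w ^ (-q))) :
    (Measure.pi fun _ : Fin N => ν) {y | ∃ i, √(N : ℝ) < |η (y i)|}
      ≤ ENNReal.ofReal (w ^ (-q) * (N : ℝ) ^ (-(q / 2 - 1))) := by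
  have hN0 : (0 : ℝ) < N := by exact_mod_cast hN
  have hA : MeasurableSet {x | √(N : ℝ) < |η x|} := measurableSet_lt measurable_const hη.abs
  refine (measure_pi_exists_le hA).trans ?_
  have h1 : ν {x | √(N : ℝ) < |η x|} ≤ ENNReal.ofReal (w ^ (-q) / (√(N : ℝ)) ^ q) := by
    refine (measure_mono fun x hx => ?_).trans
      (measure_le_ofReal_div (hη.abs.pow_const q) (by positivity) hint)
    have hx' : √(N : ℝ) < |η x| := hx
    exact Real.rpow_le_rpow (by positivity) hx'.le (by linarith)
  calc (N : ℝ≥0∞) * ν {x | √(N : ℝ) < |η x|}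
      ≤ ENNReal.ofReal N * ENNReal.ofReal (w ^ (-q) / (√(N : ℝ)) ^ q) := by
        rw [ENNReal.ofReal_natCast]; gcongr
    _ = ENNReal.ofReal (w ^ (-q) * (N : ℝ) ^ (-(q / 2 - 1))) := by
        rw [← ENNReal.ofReal_mul hN0.le]
        congr 1
        rw [Real.sqrt_eq_rpow, ← Real.rpow_mul hN0.le, div_eq_mul_inv, ← Real.rpow_neg hN0.le,
          mul_left_comm]
        congr 1
        rw [← Real.rpow_one_add' hN0.le (by linarith)]
        congr 1; ring

/-- A single exceedance has probability at most w^{-q} N^{-q/b}, so k of them cost about (w^{-q}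
N^{1-q/b})^k. Since b < q, a fixed k reaches the required power of N. -/
theorem measure_pi_card_multiplier_ge (hq : 2 < q) (hN : 1 ≤ N) (hw : 1 ≤ w) {b : ℝ} (hb : 0 < b)
    (hbq : b < q) {k : ℕ} (hk : 1 ≤ k) (hkq : q / 2 - 1 ≤ k * (q / b - 1)) (hη : Measurable η)
    (hint : ∫⁻ x, ENNReal.ofReal (|η x| ^ q) ∂ν ≤ ENNReal.ofReal (w ^ (-q))) :
    (Measure.pi fun _ : Fin N => ν)
        {y | (k : ℝ) ≤ ∑ i, (if (N : ℝ) ^ (1 / b) < |η (y i)| then (1 : ℝ) else 0)}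
      ≤ ENNReal.ofReal (Real.exp 1 * (w ^ (-q) * (N : ℝ) ^ (-(q / 2 - 1)))) := by
  have hN0 : (0 : ℝ) < N := by exact_mod_cast hN
  have hN1 : (1 : ℝ) ≤ N := by exact_mod_cast hN
  have hw0 : 0 < w := by linarith
  have hn : 0 ≤ Real.log N := Real.log_nonneg hN1
  have hl : 0 ≤ Real.log w := Real.log_nonneg hw
  have hqb : 0 < q / b - 1 := by
    rw [sub_pos, one_lt_div hb]; exact hbq
  have hk1 : (1 : ℝ) ≤ k := by exact_mod_cast hk
  set v : ℝ := w ^ (-q) * (N : ℝ) ^ (-(q / b)) with hv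
  -- Chosen so that N · v · e^L = 1, which leaves exactly the factor e in front.
  set L : ℝ := q * Real.log w + (q / b - 1) * Real.log N with hL
  have hL0 : 0 ≤ L := by positivity
  have key := measure_pi_sum_ge_le (ν := ν) (N := N) (L := L) (t := k) (B := 1) (v := v)
    (V := fun x => if (N : ℝ) ^ (1 / b) < |η x| then (1 : ℝ) else 0)
    (Measurable.ite (measurableSet_lt measurable_const hη.abs) measurable_const measurable_const)
    one_pos (fun x => by positivity) (fun x => by split_ifs <;> norm_num) (by positivity) hL0
    (by
      have hc : (0 : ℝ) < (N : ℝ) ^ (-(q / b)) := by positivity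
      calc ∫⁻ x, ENNReal.ofReal (if (N : ℝ) ^ (1 / b) < |η x| then (1 : ℝ) else 0) ∂ν
          ≤ ∫⁻ x, ENNReal.ofReal (|η x| ^ q) * ENNReal.ofReal ((N : ℝ) ^ (-(q / b))) ∂ν := by
            refine lintegral_mono fun x => ?_
            rw [← ENNReal.ofReal_mul (by positivity)]
            apply ENNReal.ofReal_le_ofReal
            split_ifs with h
            · rw [Real.rpow_neg hN0.le, ← div_eq_mul_inv, one_le_div (by positivity)]
              calc (N : ℝ) ^ (q / b) = ((N : ℝ) ^ (1 / b)) ^ q := by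
                    rw [← Real.rpow_mul hN0.le]; congr 1; ring
                _ ≤ |η x| ^ q := Real.rpow_le_rpow (by positivity) h.le (by linarith)
            · positivity
        _ = (∫⁻ x, ENNReal.ofReal (|η x| ^ q) ∂ν) * ENNReal.ofReal ((N : ℝ) ^ (-(q / b))) :=
            lintegral_mul_const _ (hη.abs.pow_const q).ennreal_ofReal
        _ ≤ ENNReal.ofReal (w ^ (-q)) * ENNReal.ofReal ((N : ℝ) ^ (-(q / b))) := by gcongr
        _ = ENNReal.ofReal v := by rw [← ENNReal.ofReal_mul (by positivity)])
  refine key.trans (ENNReal.ofReal_le_ofReal ?_)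
  have h1 : (N : ℝ) * (v / 1 * Real.exp L) = 1 := by
    rw [hv, hL, Real.rpow_def_of_pos hw0, Real.rpow_def_of_pos hN0]
    nth_rewrite 1 [← Real.exp_log hN0]
    rw [div_one, ← Real.exp_add, ← Real.exp_add, ← Real.exp_add, Real.exp_eq_one_iff]
    ring
  rw [h1, Real.rpow_def_of_pos hw0, Real.rpow_def_of_pos hN0, ← Real.exp_add, ← Real.exp_add]
  apply Real.exp_le_exp.2
  have h2 : q * Real.log w ≤ k * (q * Real.log w) :=
    le_mul_of_one_le_left (by positivity) hk1
  have h3 := mul_le_mul_of_nonneg_right hkq hn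
  rw [hL]
  nlinarith

/-- The summands are bounded by N^{a/b}, a power below N, so exceeding a multiple of N has
probability exponentially small in N^{1-a/b}. -/
theorem measure_pi_truncated_power_sum_ge (hq : 2 < q) (hN : 1 ≤ N) (hw : Real.exp 1 ≤ w) {a b D : ℝ}
    (ha : 0 < a) (hab : a < b) (haq : a ≤ q)
    (hD : q + 1 + (q / 2 - 1) / (1 - a / b) ≤ q * D) (hη : Measurable η)
    (hint : ∫⁻ x, ENNReal.ofReal (|η x| ^ q) ∂ν ≤ ENNReal.ofReal (w ^ (-q))) :
    (Measure.pi fun _ : Fin N => ν)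
        {y | D * N ≤ ∑ i, (if 1 < |η (y i)| ∧ |η (y i)| ≤ (N : ℝ) ^ (1 / b)
          then |η (y i)| ^ a else 0)}
      ≤ ENNReal.ofReal (w ^ (-q) * (N : ℝ) ^ (-(q / 2 - 1))) := by
  have hN0 : (0 : ℝ) < N := by exact_mod_cast hN
  have hN1 : (1 : ℝ) ≤ N := by exact_mod_cast hN
  have hw0 : 0 < w := (Real.exp_pos 1).trans_le hw
  have hn : 0 ≤ Real.log N := Real.log_nonneg hN1
  have hl : 1 ≤ Real.log w := (Real.le_log_iff_exp_le hw0).2 hw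
  have hb : 0 < b := ha.trans hab
  have hθ : 0 < 1 - a / b := by rw [sub_pos, div_lt_one hb]; exact hab
  have hB : 0 < (N : ℝ) ^ (a / b) := by positivity
  have hm : Measurable fun x => if 1 < |η x| ∧ |η x| ≤ (N : ℝ) ^ (1 / b) then |η x| ^ a else 0 :=
    Measurable.ite ((measurableSet_lt measurable_const hη.abs).inter
      (measurableSet_le hη.abs measurable_const)) (hη.abs.pow_const _) measurable_const
  have key := measure_pi_sum_ge_le (ν := ν) (N := N) (L := q * Real.log w) (t := D * N)
    (B := (N : ℝ) ^ (a / b)) (v := w ^ (-q)) hm hB (fun x => by positivity)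
    (fun x => by
      split_ifs with h
      · calc |η x| ^ a ≤ ((N : ℝ) ^ (1 / b)) ^ a := Real.rpow_le_rpow (abs_nonneg _) h.2 ha.le
          _ = (N : ℝ) ^ (a / b) := by rw [← Real.rpow_mul hN0.le]; congr 1; ring
      · exact hB.le) (by positivity) (by positivity)
    (by
      refine (lintegral_mono fun x => ENNReal.ofReal_le_ofReal ?_).trans hint
      split_ifs with h
      · exact Real.rpow_le_rpow_of_exponent_le h.1.le haq
      · positivity)
  refine key.trans (ENNReal.ofReal_le_ofReal ?_)
  set M : ℝ := (N : ℝ) ^ (1 - a / b) with hM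
  have hM1 : 1 ≤ M := Real.one_le_rpow hN1 hθ.le
  have hMl : (1 - a / b) * Real.log N ≤ M := by
    have := Real.log_le_sub_one_of_pos (x := M) (by positivity)
    rw [hM, Real.log_rpow hN0] at this
    linarith
  have hNM : (N : ℝ) / (N : ℝ) ^ (a / b) = M := by
    rw [hM, Real.rpow_sub hN0, Real.rpow_one]
  have h1 : (N : ℝ) * (w ^ (-q) / (N : ℝ) ^ (a / b) * Real.exp (q * Real.log w))
      - q * Real.log w * (D * N) / (N : ℝ) ^ (a / b) = M - q * D * Real.log w * M := by
    rw [← hNM]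
    have : w ^ (-q) * Real.exp (q * Real.log w) = 1 := by
      rw [Real.rpow_def_of_pos hw0, ← Real.exp_add, Real.exp_eq_one_iff]; ring
    calc _ = (w ^ (-q) * Real.exp (q * Real.log w)) * (N / (N : ℝ) ^ (a / b))
          - q * D * Real.log w * (N / (N : ℝ) ^ (a / b)) := by ring
      _ = _ := by rw [this, one_mul]
  rw [h1, Real.rpow_def_of_pos hw0, Real.rpow_def_of_pos hN0, ← Real.exp_add]
  apply Real.exp_le_exp.2
  set ℓ := Real.log w
  set e := (q / 2 - 1) / (1 - a / b) with he
  have he0 : 0 ≤ e := div_nonneg (by linarith) hθ.le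
  have hℓM : 1 ≤ ℓ * M := one_le_mul_of_one_le_of_one_le hl hM1
  -- The three parts of q + 1 + e pay, in order, for w^{-q}, for the term M in the exponent, and for
  -- the power of N, the last because (1 - a/b) log N ≤ M. The hypothesis w ≥ e enters as ℓ ≥ 1.
  have h2 : (q + 1 + e) * (ℓ * M) ≤ q * D * (ℓ * M) := by gcongr
  have h4 : M ≤ ℓ * M := le_mul_of_one_le_left (by linarith) hl
  have h3 : (q / 2 - 1) * Real.log N ≤ e * (ℓ * M) := by
    calc (q / 2 - 1) * Real.log N = e * ((1 - a / b) * Real.log N) := by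
          rw [he, ← mul_assoc, div_mul_cancel₀ _ hθ.ne']
      _ ≤ e * (ℓ * M) := mul_le_mul_of_nonneg_left (hMl.trans h4) he0
  have h5 : q * ℓ ≤ q * (ℓ * M) := by
    gcongr; exact le_mul_of_one_le_right (by linarith) hM1
  nlinarith

theorem exists_measure_compl_multiplierEvent_le {q a b : ℝ} (hq : 2 < q) (ha : 0 < a) (hab : a < b)
    (hbq : b < q) : ∃ (D : ℝ) (k : ℕ), 0 < D ∧
    ∀ {E : Type*} [MeasurableSpace E] {ν : Measure E} [IsProbabilityMeasure ν] {N : ℕ} {η : E → ℝ}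
      {w : ℝ}, 1 ≤ N → Measurable η → Real.exp 1 ≤ w →
      ∫⁻ x, ENNReal.ofReal (|η x| ^ q) ∂ν ≤ ENNReal.ofReal (w ^ (-q)) →
      (Measure.pi fun _ : Fin N => ν) (multiplierEvent N a b D k η)ᶜ
        ≤ ENNReal.ofReal (5 * (w ^ (-q) * (N : ℝ) ^ (-(q / 2 - 1)))) := by
  have hb : 0 < b := ha.trans hab
  have hqb : 0 < q / b - 1 := by
    rw [sub_pos, one_lt_div hb]; exact hbq
  have hθ : 0 < 1 - a / b := by rw [sub_pos, div_lt_one hb]; exact hab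
  have hq0 : 0 < q := by linarith
  set e := (q / 2 - 1) / (1 - a / b) with he
  have he0 : 0 ≤ e := div_nonneg (by linarith) hθ.le
  refine ⟨(q + 1 + e) / q, ⌈(q / 2 - 1) / (q / b - 1)⌉₊ + 1, by positivity, ?_⟩
  intro E _ ν _ N η w hN hη hw hint
  have hw1 : 1 ≤ w := le_trans (by linarith [Real.add_one_le_exp (1 : ℝ)]) hw
  set D := (q + 1 + e) / q
  set k := ⌈(q / 2 - 1) / (q / b - 1)⌉₊ + 1 with hk
  have hkq : q / 2 - 1 ≤ k * (q / b - 1) := by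
    rw [← div_le_iff₀ hqb, hk]
    push_cast
    linarith [Nat.le_ceil ((q / 2 - 1) / (q / b - 1))]
  have h1 := measure_pi_exists_multiplier_gt (ν := ν) (N := N) (w := w) hq hN hη hint
  have h2 := measure_pi_card_multiplier_ge (ν := ν) (N := N) (w := w) hq hN hw1 hb hbq
    (k := k) (by omega) hkq hη hint
  have h3 := measure_pi_truncated_power_sum_ge (ν := ν) (N := N) (w := w) (D := D) hq hN hw ha hab
    (by linarith) (by rw [← he]; exact (mul_div_cancel₀ _ hq0.ne').ge) hη hint
  have hsub : (multiplierEvent N a b D k η)ᶜ ⊆ {y | ∃ i, √(N : ℝ) < |η (y i)|} ∪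
      ({y | (k : ℝ) ≤ ∑ i, (if (N : ℝ) ^ (1 / b) < |η (y i)| then (1 : ℝ) else 0)} ∪
      {y | D * N ≤ ∑ i, (if 1 < |η (y i)| ∧ |η (y i)| ≤ (N : ℝ) ^ (1 / b)
          then |η (y i)| ^ a else 0)}) := by
    intro y hy
    by_contra hcon
    apply hy
    simp only [Set.mem_union, not_or, Set.mem_ofPred_eq, not_exists, not_le, not_lt] at hcon
    exact ⟨hcon.1, hcon.2.1, hcon.2.2⟩
  refine (measure_mono hsub).trans ((measure_union_le _ _).trans ?_)
  refine (add_le_add h1 ((measure_union_le _ _).trans (add_le_add h2 h3))).trans ?_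
  have hx : 0 ≤ w ^ (-q) * (N : ℝ) ^ (-(q / 2 - 1)) := by positivity
  rw [← ENNReal.ofReal_add (by positivity) hx, ← ENNReal.ofReal_add hx (by positivity)]
  apply ENNReal.ofReal_le_ofReal
  -- The three failure probabilities contribute 1 + e + 1 ≤ 5.
  nlinarith [Real.exp_one_lt_d9]

end Multipliers

/-! ### Moment and tail estimates for one normalised function. -/

section Increments

variable {E : Type*}

/-- Combines n^n ≤ e^n n! for n = j + M with (j+M)! ≤ 2^{j+M} j! M!. The constant 1/(8e) is what
leaves the geometric factor 2^{-j}. -/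
theorem pow_add_div_factorial_le (j M : ℕ) :
    (1 / (8 * Real.exp 1)) ^ j * (2 * j + 2 * M : ℝ) ^ (j + M) / j.factorial
      ≤ M.factorial * (4 * Real.exp 1) ^ M * (1 / 2) ^ j := by
  have he : 0 < Real.exp 1 := Real.exp_pos 1
  have h1 : ((j + M : ℕ) : ℝ) ^ (j + M) ≤ Real.exp 1 ^ (j + M) * (j + M).factorial := by
    have := Real.pow_div_factorial_le_exp (x := ((j + M : ℕ) : ℝ)) (by positivity) (j + M)
    rw [div_le_iff₀ (by positivity)] at this
    rwa [← Real.exp_one_pow] at this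
  have h2 : ((j + M).factorial : ℝ) ≤ 2 ^ (j + M) * j.factorial * M.factorial := by
    have := Nat.add_choose_mul_factorial_mul_factorial j M
    rw [← this]
    push_cast
    gcongr
    exact_mod_cast Nat.choose_le_two_pow _ _
  have h3 : (2 * j + 2 * M : ℝ) ^ (j + M) = 2 ^ (j + M) * ((j + M : ℕ) : ℝ) ^ (j + M) := by
    rw [← mul_pow]; push_cast; ring
  rw [h3, div_le_iff₀ (by positivity)]
  calc (1 / (8 * Real.exp 1)) ^ j * (2 ^ (j + M) * ((j + M : ℕ) : ℝ) ^ (j + M))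
      ≤ (1 / (8 * Real.exp 1)) ^ j * (2 ^ (j + M) * (Real.exp 1 ^ (j + M)
          * (2 ^ (j + M) * j.factorial * M.factorial))) := by
        gcongr
        exact h1.trans (by gcongr)
    _ = M.factorial * (4 * Real.exp 1) ^ M * ((1 / (8 * Real.exp 1)) * (4 * Real.exp 1)) ^ j
          * j.factorial := by
        rw [mul_pow (1 / (8 * Real.exp 1))]
        have : (4 * Real.exp 1) = 2 * Real.exp 1 * 2 := by ring
        rw [this]
        simp only [pow_add, mul_pow]
        ring
    _ = _ := by
        congr 3
        field_simp
        norm_num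

/-- The part of `z ^ 2` above the level `K`. -/
noncomputable def largeSq (K : ℝ) (z : E → ℝ) (x : E) : ℝ := if K < |z x| then z x ^ 2 else 0

theorem largeSq_nonneg (K : ℝ) (z : E → ℝ) (x : E) : 0 ≤ largeSq K z x := by
  unfold largeSq; positivity

/-- Where |z| > K, the 2M additional powers of |z| are worth at least K^{2M} = σ². This gain of
σ^{-2} later cancels the sum over N = σ²p indices. -/
theorem largeSq_pow_le {K σ : ℝ} {M j : ℕ} (hK : 0 ≤ K) (hσ : 0 < σ) (hKσ : K ^ (2 * M) = σ ^ 2)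
    (hj : 1 ≤ j) (z : E → ℝ) (x : E) :
    largeSq K z x ^ j ≤ |z x| ^ (2 * j + 2 * M : ℝ) * (1 / σ ^ 2) := by
  have hc : |z x| ^ (2 * j + 2 * M : ℝ) = |z x| ^ (2 * j) * |z x| ^ (2 * M) := by
    rw [← pow_add, ← Real.rpow_natCast]; push_cast; rfl
  rw [hc]
  unfold largeSq
  split_ifs with h
  · rw [← sq_abs, ← pow_mul, mul_assoc]
    refine le_mul_of_one_le_right (by positivity) ?_
    rw [mul_one_div, one_le_div (by positivity), ← hKσ]
    exact pow_le_pow_left₀ hK h.le _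
  · rw [zero_pow (by omega)]
    positivity

theorem sq_mul_le_rpow_add {q : ℝ} (hq : 2 < q) (s : ℝ) {y : ℝ} (hy : 0 ≤ y) :
    s ^ 2 * y ≤ |s| ^ q + y ^ (q / (q - 2)) := by
  have hq0 : 0 < q - 2 := by linarith
  have hpq : (q / 2).HolderConjugate (q / (q - 2)) := by
    rw [Real.holderConjugate_iff]
    constructor
    · linarith
    · field_simp; ring
  refine (Real.young_inequality_of_nonneg (sq_nonneg s) hy hpq).trans ?_
  have h1 : (s ^ 2) ^ (q / 2) = |s| ^ q := by
    rw [← sq_abs, ← Real.rpow_natCast, ← Real.rpow_mul (abs_nonneg s)]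
    congr 1; push_cast; ring
  rw [h1]
  gcongr
  · exact div_le_self (by positivity) (by linarith)
  · exact div_le_self (by positivity) (by rw [le_div_iff₀ hq0]; linarith)

variable [MeasurableSpace E]

/-- The moments of `z` of order `r ∈ [1, p]` are at most those allowed by `‖z‖_r ≤ √r`. -/
def MomentsUpTo (ν : Measure E) (p : ℝ) (z : E → ℝ) : Prop :=
  ∀ r, 1 ≤ r → r ≤ p → ∫⁻ x, ENNReal.ofReal (|z x| ^ r) ∂ν ≤ ENNReal.ofReal (r ^ (r / 2))

theorem measurable_largeSq (K : ℝ) {z : E → ℝ} (hz : Measurable z) : Measurable (largeSq K z) :=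
  Measurable.ite (measurableSet_lt measurable_const hz.abs) (hz.pow_const 2) measurable_const

variable {ν : Measure E} {N : ℕ} {z : E → ℝ} {p : ℝ}

/-- Young's inequality with exponents q/2 and q/(q-2) separates η from z without any independence.
-/
theorem MomentsUpTo.lintegral_sq_mul_le (hz : MomentsUpTo ν p z) (hzm : Measurable z) {η : E → ℝ}
    (hη : Measurable η) {q : ℝ} (hq : 2 < q)
    (hint : ∫⁻ x, ENNReal.ofReal (|η x| ^ q) ∂ν ≤ 1) {r : ℝ} (hr : 1 ≤ r * (q / (q - 2)))
    (hrp : r * (q / (q - 2)) ≤ p) :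
    ∫⁻ x, ENNReal.ofReal (η x ^ 2 * |z x| ^ r) ∂ν
      ≤ ENNReal.ofReal (2 * (r * (q / (q - 2))) ^ (r / 2)) := by
  have hq0 : 0 < q - 2 := by linarith
  set κ := q / (q - 2) with hκ
  have hκ0 : 0 < κ := by positivity
  set L := (r * κ) ^ (r / 2) with hL
  have hrk : 0 < r * κ := by linarith
  have hL0 : 0 < L := by positivity
  have hpt : ∀ x, η x ^ 2 * |z x| ^ r
      ≤ L * |η x| ^ q + L / (r * κ) ^ (r * κ / 2) * |z x| ^ (r * κ) := by
    intro x
    -- Scaling by L makes both Young terms have integral at most 1, hence the factor 2.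
    have h := sq_mul_le_rpow_add hq (η x) (y := |z x| ^ r / L) (by positivity)
    rw [← hκ, Real.div_rpow (by positivity) hL0.le, ← Real.rpow_mul (abs_nonneg _), hL,
      ← Real.rpow_mul hrk.le, ← hL] at h
    calc η x ^ 2 * |z x| ^ r = L * (η x ^ 2 * (|z x| ^ r / L)) := by field_simp
      _ ≤ L * (|η x| ^ q + |z x| ^ (r * κ) / (r * κ) ^ (r / 2 * κ)) := by gcongr
      _ = _ := by
        rw [show r / 2 * κ = r * κ / 2 by ring]; ring
  have hd : 0 ≤ L / (r * κ) ^ (r * κ / 2) := by positivity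
  calc ∫⁻ x, ENNReal.ofReal (η x ^ 2 * |z x| ^ r) ∂ν
      ≤ ∫⁻ x, (ENNReal.ofReal L * ENNReal.ofReal (|η x| ^ q)
          + ENNReal.ofReal (L / (r * κ) ^ (r * κ / 2)) * ENNReal.ofReal (|z x| ^ (r * κ))) ∂ν := by
        refine lintegral_mono fun x => ?_
        rw [← ENNReal.ofReal_mul hL0.le, ← ENNReal.ofReal_mul hd,
          ← ENNReal.ofReal_add (by positivity) (by positivity)]
        exact ENNReal.ofReal_le_ofReal (hpt x)
    _ = ENNReal.ofReal L * (∫⁻ x, ENNReal.ofReal (|η x| ^ q) ∂ν)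
        + ENNReal.ofReal (L / (r * κ) ^ (r * κ / 2))
          * ∫⁻ x, ENNReal.ofReal (|z x| ^ (r * κ)) ∂ν := by
        have h1 := (hη.abs.pow_const q).ennreal_ofReal
        have h2 := (hzm.abs.pow_const (r * κ)).ennreal_ofReal
        rw [lintegral_add_left (h1.const_mul _), lintegral_const_mul _ h1,
          lintegral_const_mul _ h2]
    _ ≤ ENNReal.ofReal L * 1 + ENNReal.ofReal (L / (r * κ) ^ (r * κ / 2))
          * ENNReal.ofReal ((r * κ) ^ (r * κ / 2)) := by
        gcongr
        exact hz _ hr hrp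
    _ = _ := by
        rw [← ENNReal.ofReal_mul hd, mul_one, ← ENNReal.ofReal_add hL0.le (by positivity)]
        congr 1
        field_simp
        norm_num

theorem MomentsUpTo.lintegral_largeSq_pow_le (hz : MomentsUpTo ν p z) (hzm : Measurable z)
    {K σ : ℝ} {M j : ℕ} (hK : 0 ≤ K) (hσ : 0 < σ) (hKσ : K ^ (2 * M) = σ ^ 2)
    (hj : 1 ≤ j) (hp : (2 * j + 2 * M : ℝ) ≤ p) :
    ∫⁻ x, ENNReal.ofReal (largeSq K z x ^ j) ∂ν
      ≤ ENNReal.ofReal ((2 * j + 2 * M : ℝ) ^ (j + M) * (1 / σ ^ 2)) := by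
  have hj' : (1 : ℝ) ≤ j := by exact_mod_cast hj
  have hM' : (0 : ℝ) ≤ M := by positivity
  calc ∫⁻ x, ENNReal.ofReal (largeSq K z x ^ j) ∂ν
      ≤ ∫⁻ x, ENNReal.ofReal (|z x| ^ (2 * j + 2 * M : ℝ)) * ENNReal.ofReal (1 / σ ^ 2) ∂ν := by
        refine lintegral_mono fun x => ?_
        rw [← ENNReal.ofReal_mul (by positivity)]
        exact ENNReal.ofReal_le_ofReal (largeSq_pow_le hK hσ hKσ hj z x)
    _ = (∫⁻ x, ENNReal.ofReal (|z x| ^ (2 * j + 2 * M : ℝ)) ∂ν) * ENNReal.ofReal (1 / σ ^ 2) :=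
        lintegral_mul_const _ (hzm.abs.pow_const _).ennreal_ofReal
    _ ≤ ENNReal.ofReal ((2 * j + 2 * M : ℝ) ^ ((2 * j + 2 * M : ℝ) / 2))
          * ENNReal.ofReal (1 / σ ^ 2) := by
        gcongr
        exact hz _ (by linarith) hp
    _ = _ := by
        have h : (2 * j + 2 * M : ℝ) / 2 = ((j + M : ℕ) : ℝ) := by push_cast; ring
        rw [← ENNReal.ofReal_mul (by positivity), h, Real.rpow_natCast]

variable [IsProbabilityMeasure ν]

/-- Term by term, the j-th moment of the large square over j! is at most a constant times 2^{-j}/σ².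
The series then sums geometrically, uniformly in k. -/
theorem MomentsUpTo.lintegral_truncExp_le (hz : MomentsUpTo ν p z) (hzm : Measurable z)
    {K σ : ℝ} {M k : ℕ} (hK : 0 ≤ K) (hσ : 0 < σ) (hKσ : K ^ (2 * M) = σ ^ 2)
    (hp : (2 * k + 2 * M : ℝ) ≤ p) :
    ∫⁻ x, ENNReal.ofReal (truncExp k (1 / (8 * Real.exp 1) * largeSq K z x)) ∂ν
      ≤ ENNReal.ofReal (1 + M.factorial * (4 * Real.exp 1) ^ M / σ ^ 2) := by
  set c : ℝ := 1 / (8 * Real.exp 1) with hc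
  set A : ℝ := M.factorial * (4 * Real.exp 1) ^ M with hA
  have hc0 : 0 < c := by positivity
  have hW0 := largeSq_nonneg K z
  have hWm := measurable_largeSq K hzm
  have hsum : ∀ x, ENNReal.ofReal (truncExp k (c * largeSq K z x)) = 1 + ∑ j ∈ Finset.range k,
      ENNReal.ofReal (c ^ (j + 1) / (j + 1).factorial) * ENNReal.ofReal (largeSq K z x ^ (j + 1)) := by
    intro x
    unfold truncExp
    rw [Finset.sum_range_succ', add_comm, ENNReal.ofReal_add (by simp)
      (Finset.sum_nonneg fun j _ => by have := hW0 x; positivity),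
      ENNReal.ofReal_sum_of_nonneg (fun j _ => by have := hW0 x; positivity)]
    congr 1
    · simp
    · refine Finset.sum_congr rfl fun j _ => ?_
      rw [← ENNReal.ofReal_mul (by positivity), mul_pow]
      congr 1; ring
  simp_rw [hsum]
  rw [lintegral_add_left measurable_const, lintegral_finsetSum _ fun j _ =>
    ((hWm.pow_const _).ennreal_ofReal.const_mul _)]
  have hterm : ∀ j ∈ Finset.range k, ∫⁻ x, ENNReal.ofReal (c ^ (j + 1) / (j + 1).factorial)
      * ENNReal.ofReal (largeSq K z x ^ (j + 1)) ∂ν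
      ≤ ENNReal.ofReal (A * (1 / 2) ^ (j + 1) * (1 / σ ^ 2)) := by
    intro j hj
    have hjk : ((j + 1 : ℕ) : ℝ) ≤ k := by exact_mod_cast Finset.mem_range.1 hj
    rw [lintegral_const_mul _ (hWm.pow_const _).ennreal_ofReal]
    calc _ ≤ ENNReal.ofReal (c ^ (j + 1) / (j + 1).factorial) * ENNReal.ofReal
          ((2 * (j + 1 : ℕ) + 2 * M : ℝ) ^ (j + 1 + M) * (1 / σ ^ 2)) := by
          gcongr
          exact hz.lintegral_largeSq_pow_le hzm hK hσ hKσ (by omega) (by linarith)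
      _ = ENNReal.ofReal (c ^ (j + 1) * (2 * (j + 1 : ℕ) + 2 * M : ℝ) ^ (j + 1 + M)
            / (j + 1).factorial * (1 / σ ^ 2)) := by
          rw [← ENNReal.ofReal_mul (by positivity)]; congr 1; ring
      _ ≤ _ := by
          apply ENNReal.ofReal_le_ofReal
          gcongr
          exact pow_add_div_factorial_le (j + 1) M
  have hgeo : ∑ j ∈ Finset.range k, (1 / 2 : ℝ) ^ (j + 1) ≤ 1 := by
    simp_rw [pow_succ]
    rw [← Finset.sum_mul, geom_sum_eq (by norm_num)]
    have h1 : (0 : ℝ) ≤ (1 / 2) ^ k := by positivity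
    have h2 : (((1 / 2 : ℝ) ^ k - 1) / (1 / 2 - 1)) * (1 / 2) = 1 - (1 / 2) ^ k := by ring
    linarith
  calc _ ≤ 1 + ∑ j ∈ Finset.range k, ENNReal.ofReal (A * (1 / 2) ^ (j + 1) * (1 / σ ^ 2)) := by
        gcongr with j hj
        · simp
        · exact hterm j hj
    _ = ENNReal.ofReal (1 + A * (∑ j ∈ Finset.range k, (1 / 2) ^ (j + 1)) * (1 / σ ^ 2)) := by
        rw [← ENNReal.ofReal_sum_of_nonneg (fun j _ => by positivity), ENNReal.ofReal_add
          zero_le_one (by positivity), ENNReal.ofReal_one, Finset.mul_sum, Finset.sum_mul]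
    _ ≤ _ := by
        apply ENNReal.ofReal_le_ofReal
        rw [div_eq_mul_one_div A]
        gcongr
        exact mul_le_of_le_one_right (by positivity) hgeo

/-- Exponential tail bound for the sum of the large squares. -/
theorem exists_measure_pi_sum_largeSq_ge_le (M : ℕ) {κ : ℝ} (hκ : 0 < κ) : ∃ D : ℝ, 0 < D ∧
    ∀ {E : Type*} [MeasurableSpace E] {ν : Measure E} [IsProbabilityMeasure ν] {N : ℕ} {z : E → ℝ}
      {p K σ : ℝ}, 4 * M + 4 ≤ p → Measurable z → MomentsUpTo ν p z → 0 ≤ K → 0 < σ →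
      K ^ (2 * M) = σ ^ 2 → (N : ℝ) = σ ^ 2 * p →
      (Measure.pi fun _ : Fin N => ν) {y | D * p ≤ ∑ i, largeSq K z (y i)}
        ≤ ENNReal.ofReal (Real.exp (-(κ * p))) := by
  set A : ℝ := M.factorial * (4 * Real.exp 1) ^ M with hA
  have hA0 : 0 < A := by positivity
  set c : ℝ := 1 / (8 * Real.exp 1) with hc
  have hc0 : 0 < c := by positivity
  refine ⟨Real.exp (4 * (A + κ)) / c, by positivity, ?_⟩
  intro E _ ν _ N z p K σ hp hzm hz hK hσ hKσ hN
  have hM : (0 : ℝ) ≤ M := by positivity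
  have hp0 : 0 < p := by linarith
  -- The largest order with 2k + 2M ≤ p, so that every moment used is available; p ≥ 4M + 4 keeps k
  -- ≥ p/4. With k! ≤ p^k, the threshold e^{4(A+κ)}p then gains e^{(A+κ)p}, against a cost of
  -- e^{Ap}.
  set k : ℕ := ⌊p / 2⌋₊ - M with hk
  have hfl : p / 2 - 1 < ⌊p / 2⌋₊ := Nat.sub_one_lt_floor _
  have hMfl : M ≤ ⌊p / 2⌋₊ := Nat.le_floor (by linarith)
  have hkR : (k : ℝ) = ⌊p / 2⌋₊ - M := by rw [hk, Nat.cast_sub hMfl]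
  have hflu : (⌊p / 2⌋₊ : ℝ) ≤ p / 2 := Nat.floor_le (by positivity)
  have hkp : (2 * k + 2 * M : ℝ) ≤ p := by rw [hkR]; linarith
  have hk4 : p / 4 ≤ k := by rw [hkR]; linarith
  have key := measure_pi_sum_ge_le_truncExp (ν := ν) (N := N) (W := fun x => c * largeSq K z x)
    ((measurable_largeSq K hzm).const_mul c)
    (fun x => mul_nonneg hc0.le (largeSq_nonneg K z x)) k (δ := A / σ ^ 2)
    (t := Real.exp (4 * (A + κ)) * p) (by positivity) (by positivity)
    (hz.lintegral_truncExp_le hzm hK hσ hKσ hkp)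
  have hset : {y : Fin N → E | Real.exp (4 * (A + κ)) / c * p ≤ ∑ i, largeSq K z (y i)}
      ⊆ {y | Real.exp (4 * (A + κ)) * p ≤ ∑ i, c * largeSq K z (y i)} := by
    intro y hy
    have hy' : Real.exp (4 * (A + κ)) / c * p ≤ ∑ i, largeSq K z (y i) := hy
    show Real.exp (4 * (A + κ)) * p ≤ ∑ i, c * largeSq K z (y i)
    rw [← Finset.mul_sum]
    calc _ = c * (Real.exp (4 * (A + κ)) / c * p) := by field_simp
      _ ≤ _ := by gcongr
  refine (measure_mono hset).trans (key.trans (ENNReal.ofReal_le_ofReal ?_))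
  have h1 : (N : ℝ) * (A / σ ^ 2) = A * p := by rw [hN]; field_simp
  have hfac : (k.factorial : ℝ) ≤ p ^ k := by
    calc (k.factorial : ℝ) ≤ (k : ℝ) ^ k := by exact_mod_cast Nat.factorial_le_pow k
      _ ≤ p ^ k := by gcongr; linarith
  have h2 : Real.exp (k * (4 * (A + κ)))
      ≤ (Real.exp (4 * (A + κ)) * p) ^ k / k.factorial := by
    rw [le_div_iff₀ (by positivity), mul_pow, Real.exp_nat_mul]
    gcongr
  rw [h1, div_le_iff₀ (by positivity)]
  calc Real.exp (A * p) ≤ Real.exp (-(κ * p) + k * (4 * (A + κ))) := by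
        apply Real.exp_le_exp.2
        nlinarith [mul_le_mul_of_nonneg_right hk4 (by positivity : 0 ≤ 4 * (A + κ))]
    _ = Real.exp (-(κ * p)) * Real.exp (k * (4 * (A + κ))) := Real.exp_add _ _
    _ ≤ _ := by gcongr

/-- On |η| ≤ √N one has |ηz|^r ≤ N^{r/2-1} η²|z|^r, so Markov's inequality needs only two powers of
η, and the factor 1/N it yields absorbs the union over indices. -/
theorem MomentsUpTo.measure_pi_exists_mul_gt_le (hz : MomentsUpTo ν p z) (hzm : Measurable z)
    {η : E → ℝ} (hη : Measurable η) {q κ σ : ℝ} (hq : 2 < q) (hN : 1 ≤ N) (hσ : 0 < σ)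
    (hNσ : (N : ℝ) = σ ^ 2 * p)
    (hint : ∫⁻ x, ENNReal.ofReal (|η x| ^ q) ∂ν ≤ 1) (hp : 2 * (q / (q - 2)) ≤ p) :
    (Measure.pi fun _ : Fin N => ν) {y | ∃ i, |η (y i)| ≤ √(N : ℝ) ∧
      Real.exp (κ * (q / (q - 2))) * (σ * p) < |η (y i) * z (y i)|}
      ≤ ENNReal.ofReal (2 * Real.exp (-(κ * p))) := by
  have hq0 : 0 < q - 2 := by linarith
  set κ' := q / (q - 2) with hκ'
  have hκ'1 : 1 ≤ κ' := by rw [hκ', le_div_iff₀ hq0]; linarith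
  have hp0 : 0 < p := by linarith
  have hN0 : (0 : ℝ) < N := by exact_mod_cast hN
  -- The highest order for which Young's inequality asks for a z-moment of order at most p. The
  -- threshold constant raised to this power is e^{κp}.
  set r := p / κ' with hr
  have hr2 : 2 ≤ r := by rw [hr, le_div_iff₀ (by linarith)]; linarith
  have hrκ : r * κ' = p := by rw [hr]; field_simp
  set C := Real.exp (κ * κ') with hC
  have hmom := hz.lintegral_sq_mul_le hzm hη hq hint (r := r) (by rw [← hκ', hrκ]; linarith)
    (by rw [← hκ', hrκ])
  rw [← hκ', hrκ] at hmom
  set A : Set E := {x | |η x| ≤ √(N : ℝ) ∧ C * (σ * p) < |η x * z x|} with hA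
  have hAm : MeasurableSet A := (measurableSet_le hη.abs measurable_const).inter
    (measurableSet_lt measurable_const (hη.mul hzm).abs)
  refine (measure_pi_exists_le hAm).trans ?_
  have hgm : Measurable fun x => η x ^ 2 * |z x| ^ r := (hη.pow_const 2).mul (hzm.abs.pow_const r)
  have hbase : σ * p = √(N : ℝ) * p ^ (1 / 2 : ℝ) := by
    rw [hNσ, Real.sqrt_mul (by positivity), Real.sqrt_sq hσ.le, Real.sqrt_eq_rpow, mul_assoc,
      ← Real.rpow_add hp0]
    norm_num
  have hsN : 0 < √(N : ℝ) := by positivity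
  have hsub : A ⊆ {x | C ^ r * N * p ^ (r / 2) ≤ η x ^ 2 * |z x| ^ r} := by
    intro x hx
    have h1 : |η x| ≤ √(N : ℝ) := hx.1
    have h2 : C * (σ * p) < |η x * z x| := hx.2
    have h3 : (C * (σ * p)) ^ r ≤ |η x * z x| ^ r :=
      Real.rpow_le_rpow (by positivity) h2.le (by linarith)
    have h4 : (C * (σ * p)) ^ r = (√(N : ℝ)) ^ (r - 2) * (C ^ r * N * p ^ (r / 2)) := by
      rw [hbase, Real.mul_rpow (by positivity) (by positivity),
        Real.mul_rpow (by positivity) (by positivity), ← Real.rpow_mul hp0.le]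
      have : (√(N : ℝ)) ^ r = (√(N : ℝ)) ^ (r - 2) * N := by
        conv_rhs => rw [← Real.sq_sqrt hN0.le]
        rw [Real.sqrt_sq hsN.le, ← Real.rpow_natCast, ← Real.rpow_add hsN]
        congr 1; push_cast; ring
      rw [this, show 1 / 2 * r = r / 2 by ring]
      ring
    have h5 : |η x * z x| ^ r ≤ (√(N : ℝ)) ^ (r - 2) * (η x ^ 2 * |z x| ^ r) := by
      rw [abs_mul, Real.mul_rpow (abs_nonneg _) (abs_nonneg _), ← mul_assoc]
      gcongr
      calc |η x| ^ r = |η x| ^ (r - 2 + 2) := by congr 1; ring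
        _ = |η x| ^ (r - 2) * |η x| ^ (2 : ℝ) :=
            Real.rpow_add_of_nonneg (abs_nonneg _) (by linarith) (by norm_num)
        _ ≤ (√(N : ℝ)) ^ (r - 2) * η x ^ 2 := by
            rw [Real.rpow_two, sq_abs]
            gcongr
    have h6 := h3.trans h5
    rw [h4] at h6
    exact le_of_mul_le_mul_left h6 (by positivity)
  have h7 := (measure_mono hsub).trans (measure_le_ofReal_div hgm (by positivity) hmom)
  calc (N : ℝ≥0∞) * ν A ≤ ENNReal.ofReal N
        * ENNReal.ofReal (2 * p ^ (r / 2) / (C ^ r * N * p ^ (r / 2))) := by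
        rw [ENNReal.ofReal_natCast]; gcongr
    _ = ENNReal.ofReal (2 * Real.exp (-(κ * p))) := by
        rw [← ENNReal.ofReal_mul hN0.le]
        congr 1
        have : C ^ r = Real.exp (κ * p) := by
          rw [hC, ← Real.exp_mul, mul_assoc, mul_comm κ' r, hrκ]
        rw [this, Real.exp_neg]
        field_simp

end Increments

/-! ### Deviation of a single multiplier sum on the good event. -/

section IncrementTail

theorem sq_le_one_add_rpow {s a : ℝ} (hs : 0 ≤ s) (ha : 2 ≤ a) : s ^ 2 ≤ 1 + s ^ a := by
  rcases le_total s 1 with h | h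
  · nlinarith [Real.rpow_nonneg hs a]
  · have := Real.rpow_le_rpow_of_exponent_le h ha
    rw [Real.rpow_two] at this
    linarith

/-- The part of the product `s * t` with `|s| ≤ T` and `|t| ≤ K`. -/
noncomputable def truncMul (T K s t : ℝ) : ℝ := if |s| ≤ T ∧ |t| ≤ K then s * t else 0

theorem abs_truncMul_le {T K : ℝ} (hT : 0 ≤ T) (hK : 0 ≤ K) (s t : ℝ) :
    |truncMul T K s t| ≤ T * K := by
  unfold truncMul
  split_ifs with h
  · rw [abs_mul]
    exact mul_le_mul h.1 h.2 (abs_nonneg _) hT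
  · simpa using mul_nonneg hT hK

theorem truncMul_sq_le (T K s t : ℝ) : truncMul T K s t ^ 2 ≤ s ^ 2 * t ^ 2 := by
  unfold truncMul
  split_ifs with h
  · rw [mul_pow]
  · simp only [ne_eq, OfNat.ofNat_ne_zero, not_false_eq_true, zero_pow]
    positivity

theorem abs_mul_sub_truncMul_le_abs_mul (T K s t : ℝ) :
    |s * t - truncMul T K s t| ≤ |s * t| := by
  unfold truncMul
  split_ifs with h
  · rw [sub_self, abs_zero]
    positivity
  · rw [sub_zero]

/-- If |t| > K, use |s||t| ≤ σ^{-1}s² + σt². If |t| ≤ K but |s| > T, then |s|K = σ^{-1}|s|T^{a-1} ≤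
σ^{-1}|s|^a. -/
theorem abs_mul_sub_truncMul_le {T K σ a : ℝ} (hT : 0 < T) (hσ : 0 < σ)
    (ha : 2 ≤ a) (hTK : T * K = σ) (hTa : T ^ a = σ ^ 2) (s t : ℝ) :
    |s * t - truncMul T K s t| ≤ σ⁻¹ * (1 + |s| ^ a) + σ * (if K < |t| then t ^ 2 else 0) := by
  have hs0 : 0 ≤ |s| ^ a := by positivity
  unfold truncMul
  by_cases hK : K < |t|
  · have h1 : |s * t - if |s| ≤ T ∧ |t| ≤ K then s * t else 0| ≤ |s| * |t| := by
      rw [if_neg (fun h => absurd h.2 (not_le.2 hK)), sub_zero, abs_mul]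
    rw [if_pos hK]
    refine h1.trans ?_
    have h2 : |s| * |t| ≤ σ⁻¹ * |s| ^ 2 + σ * |t| ^ 2 := by
      have h3 : 0 ≤ σ⁻¹ * (|s| - σ * |t|) ^ 2 := by positivity
      have h4 : σ⁻¹ * (|s| - σ * |t|) ^ 2 = σ⁻¹ * |s| ^ 2 - 2 * (|s| * |t|) + σ * |t| ^ 2 := by
        field_simp
        ring
      nlinarith [mul_nonneg (abs_nonneg s) (abs_nonneg t)]
    calc _ ≤ σ⁻¹ * |s| ^ 2 + σ * |t| ^ 2 := h2
      _ ≤ _ := by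
        rw [sq_abs t]
        gcongr
        exact sq_le_one_add_rpow (abs_nonneg s) ha
  · rw [if_neg hK]
    by_cases hs : |s| ≤ T
    · rw [if_pos ⟨hs, not_lt.1 hK⟩]
      simp only [sub_self, abs_zero, mul_zero, add_zero]
      positivity
    · rw [if_neg (fun h => hs h.1), sub_zero, abs_mul, mul_zero, add_zero]
      rw [not_le] at hs
      have hs1 : 0 < |s| := hT.trans hs
      have h1 : T ^ (a - 1) ≤ |s| ^ (a - 1) := Real.rpow_le_rpow hT.le hs.le (by linarith)
      rw [Real.rpow_sub_one hT.ne', Real.rpow_sub_one hs1.ne', hTa] at h1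
      have hKeq : K = σ / T := by rw [← hTK]; field_simp
      calc |s| * |t| ≤ |s| * K := by gcongr; exact not_lt.1 hK
        _ = σ⁻¹ * (|s| * (σ ^ 2 / T)) := by rw [hKeq]; field_simp
        _ ≤ σ⁻¹ * (|s| * (|s| ^ a / |s|)) := by gcongr
        _ = σ⁻¹ * |s| ^ a := by field_simp
        _ ≤ _ := by gcongr; linarith

theorem exists_measure_pi_multiplierEvent_inter_le {q b D κ : ℝ} {M k : ℕ} (hq : 2 < q)
    (hM : 2 ≤ M) (hMq : 2 * (M : ℝ) / (M - 1) ≤ q) (hD : 0 < D) (hκ : 0 < κ) :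
    ∃ C p₀ : ℝ, 0 < C ∧ 1 ≤ p₀ ∧
    ∀ {E : Type*} [MeasurableSpace E] {ν : Measure E} [IsProbabilityMeasure ν] {N : ℕ}
      {η z : E → ℝ} {p : ℝ}, 1 ≤ N → Measurable η → Measurable z → p₀ ≤ p →
      ∫⁻ x, ENNReal.ofReal (|η x| ^ q) ∂ν ≤ 1 → MomentsUpTo ν p z →
      (Measure.pi fun _ : Fin N => ν) (multiplierEvent N (2 * (M : ℝ) / (M - 1)) b D k η ∩
        {y | C * √(N * p) < |∑ i, (η (y i) * z (y i) - ∫ x, η x * z x ∂ν)|})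
        ≤ ENNReal.ofReal (5 * Real.exp (-(κ * p))) := by
  obtain ⟨D', hD', hlarge⟩ := exists_measure_pi_sum_largeSq_ge_le M hκ
  have hq0 : 0 < q - 2 := by linarith
  set κ' := q / (q - 2) with hκ'
  have hκ'1 : 1 ≤ κ' := by rw [hκ', le_div_iff₀ hq0]; linarith
  set V : ℝ := 2 * (2 * κ') ^ ((2 : ℝ) / 2) with hV
  have hV0 : 0 < V := by positivity
  set A : ℝ := V + 2 * κ with hA
  set Cm : ℝ := Real.exp (κ * κ') with hCm
  have hM1 : (1 : ℝ) < M := by exact_mod_cast hM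
  have hM0 : (0 : ℝ) < M := by linarith
  set a : ℝ := 2 * (M : ℝ) / (M - 1) with ha
  have ha2 : 2 ≤ a := by rw [ha, le_div_iff₀ (by linarith)]; linarith
  set Q : ℝ := (2 * 1 + 2 * M) ^ (1 + M) with hQ
  have hQ0 : 0 < Q := by positivity
  -- The three groups bound, in units of σp, the centered truncated sum, the sum of remainders, and
  -- N times the mean of the remainder.
  refine ⟨A + (Cm * k + 2 + D + D') + (3 + Q), 2 * κ' + (4 * M + 4), by positivity, by linarith, ?_⟩
  intro E _ ν _ N η z p hN hη hzm hp hint hz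
  have hN0 : (0 : ℝ) < N := by exact_mod_cast hN
  have hp0 : 0 < p := by linarith
  set σ : ℝ := √(N / p) with hσdef
  have hσ : 0 < σ := Real.sqrt_pos.2 (by positivity)
  have hσ2 : σ ^ 2 = N / p := Real.sq_sqrt (by positivity)
  have hNσ : (N : ℝ) = σ ^ 2 * p := by rw [hσ2]; field_simp
  have hsq : √(N * p) = σ * p := by
    rw [hNσ, show σ ^ 2 * p * p = (σ * p) ^ 2 by ring, Real.sqrt_sq (by positivity)]
  -- The levels balance three demands: TK = σ for Bernstein, T^a = σ² for the multipliers, and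
  -- K^{2M} = σ² for the large squares. The value a = 2M/(M-1) is forced by them. No comparison
  -- between N and p is needed, so σ < 1 is allowed.
  set K : ℝ := σ ^ (1 / (M : ℝ)) with hKdef
  set T : ℝ := σ ^ (1 - 1 / (M : ℝ)) with hTdef
  have hK0 : 0 < K := by positivity
  have hT0 : 0 < T := by positivity
  have hTK : T * K = σ := by
    rw [hTdef, hKdef, ← Real.rpow_add hσ]; simp
  have hTa : T ^ a = σ ^ 2 := by
    rw [hTdef, ← Real.rpow_mul hσ.le, ← Real.rpow_two]
    congr 1
    have : (M : ℝ) - 1 ≠ 0 := by linarith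
    rw [ha]; field_simp
  have hKσ : K ^ (2 * M) = σ ^ 2 := by
    rw [hKdef, ← Real.rpow_natCast, ← Real.rpow_mul hσ.le, ← Real.rpow_two]
    congr 1
    push_cast; field_simp
  have hV1 := hz.lintegral_sq_mul_le hzm hη hq hint (r := 2) (by rw [← hκ']; linarith)
    (by rw [← hκ']; linarith)
  rw [← hκ', ← hV] at hV1
  simp only [Real.rpow_two, sq_abs] at hV1
  set φ : E → ℝ := fun x => truncMul T K (η x) (z x) with hφ
  have hφm : Measurable φ := by
    refine Measurable.ite ((measurableSet_le hη.abs measurable_const).inter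
      (measurableSet_le hzm.abs measurable_const)) (hη.mul hzm) measurable_const
  have hφB : ∀ x, |φ x| ≤ σ := fun x => by
    rw [← hTK]; exact abs_truncMul_le hT0.le hK0.le _ _
  have hφi : Integrable φ ν := Integrable.of_bound hφm.aestronglyMeasurable σ (.of_forall hφB)
  have hmi : Integrable (fun x => η x * z x) ν := by
    have h2 : MemLp (fun x => η x * z x) 2 ν := by
      refine (memLp_two_iff_integrable_sq (hη.mul hzm).aestronglyMeasurable).2 ⟨((hη.mul hzm).pow_const 2).aestronglyMeasurable, ?_⟩
      rw [hasFiniteIntegral_iff_ofReal (.of_forall fun x => sq_nonneg _)]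
      change ∫⁻ x, ENNReal.ofReal ((η x * z x) ^ 2) ∂ν < ∞
      simp only [mul_pow]
      exact hV1.trans_lt ENNReal.ofReal_lt_top
    exact h2.integrable one_le_two
  set R : E → ℝ := fun x => σ⁻¹ * (1 + |η x| ^ a) + σ * largeSq K z x with hR
  have hψR : ∀ x, |η x * z x - φ x| ≤ R x := fun x =>
    abs_mul_sub_truncMul_le hT0 hσ ha2 hTK hTa (η x) (z x)
  have hLm := measurable_largeSq K hzm
  have hηa : ∫⁻ x, ENNReal.ofReal (1 + |η x| ^ a) ∂ν ≤ ENNReal.ofReal 3 := by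
    calc ∫⁻ x, ENNReal.ofReal (1 + |η x| ^ a) ∂ν
        ≤ ∫⁻ x, (2 + ENNReal.ofReal (|η x| ^ q)) ∂ν := by
          refine lintegral_mono fun x => ?_
          rw [← ENNReal.ofReal_ofNat, ← ENNReal.ofReal_add (by norm_num) (by positivity)]
          apply ENNReal.ofReal_le_ofReal
          rcases le_total |η x| 1 with h | h
          · have h1 := Real.rpow_le_one (abs_nonneg (η x)) h (by linarith : (0 : ℝ) ≤ a)
            have h2 : 0 ≤ |η x| ^ q := by positivity
            linarith
          · have := Real.rpow_le_rpow_of_exponent_le h hMq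
            linarith
      _ = 2 + ∫⁻ x, ENNReal.ofReal (|η x| ^ q) ∂ν := by
          rw [lintegral_add_left measurable_const]; simp
      _ ≤ 2 + 1 := by gcongr
      _ = ENNReal.ofReal 3 := by rw [ENNReal.ofReal_ofNat]; norm_num
  have hL1 : ∫⁻ x, ENNReal.ofReal (largeSq K z x) ∂ν ≤ ENNReal.ofReal (Q * (1 / σ ^ 2)) := by
    have := hz.lintegral_largeSq_pow_le hzm hK0.le hσ hKσ (j := 1) le_rfl (by push_cast; linarith)
    simpa [hQ] using this
  have hRint : ∫⁻ x, ENNReal.ofReal (R x) ∂ν ≤ ENNReal.ofReal (σ⁻¹ * (3 + Q)) := by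
    calc ∫⁻ x, ENNReal.ofReal (R x) ∂ν
        = ∫⁻ x, (ENNReal.ofReal σ⁻¹ * ENNReal.ofReal (1 + |η x| ^ a)
          + ENNReal.ofReal σ * ENNReal.ofReal (largeSq K z x)) ∂ν := by
          refine lintegral_congr fun x => ?_
          have := largeSq_nonneg K z x
          rw [← ENNReal.ofReal_mul (by positivity), ← ENNReal.ofReal_mul hσ.le,
            ← ENNReal.ofReal_add (by positivity) (by positivity)]
      _ = ENNReal.ofReal σ⁻¹ * ∫⁻ x, ENNReal.ofReal (1 + |η x| ^ a) ∂ν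
          + ENNReal.ofReal σ * ∫⁻ x, ENNReal.ofReal (largeSq K z x) ∂ν := by
          have h1 : Measurable fun x => ENNReal.ofReal (1 + |η x| ^ a) :=
            (measurable_const.add (hη.abs.pow_const a)).ennreal_ofReal
          rw [lintegral_add_left (h1.const_mul _), lintegral_const_mul _ h1,
            lintegral_const_mul _ hLm.ennreal_ofReal]
      _ ≤ ENNReal.ofReal σ⁻¹ * ENNReal.ofReal 3
          + ENNReal.ofReal σ * ENNReal.ofReal (Q * (1 / σ ^ 2)) := by gcongr
      _ = _ := by
          rw [← ENNReal.ofReal_mul (by positivity), ← ENNReal.ofReal_mul hσ.le,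
            ← ENNReal.ofReal_add (by positivity) (by positivity)]
          congr 1
          field_simp
  have hψint : |∫ x, (η x * z x - φ x) ∂ν| ≤ σ⁻¹ * (3 + Q) := by
    have h1 := enorm_integral_le_lintegral_enorm (μ := ν) (fun x => η x * z x - φ x)
    have h2 : ∫⁻ x, ‖η x * z x - φ x‖ₑ ∂ν ≤ ENNReal.ofReal (σ⁻¹ * (3 + Q)) := by
      refine (lintegral_mono fun x => ?_).trans hRint
      rw [Real.enorm_eq_ofReal_abs]
      exact ENNReal.ofReal_le_ofReal (hψR x)
    have h3 := h1.trans h2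
    rw [Real.enorm_eq_ofReal_abs] at h3
    exact (ENNReal.ofReal_le_ofReal_iff (by positivity)).1 h3
  -- λ = 1/(2σ) is the largest value allowed by the bound σ; the exponent becomes p(V/4 - A/2), and
  -- A = V + 2κ makes it at most -κp.
  have e1 := measure_pi_abs_sum_centered_ge_le (ν := ν) (N := N) (t := A * (σ * p))
    (lam := 1 / (2 * σ)) hφm hφB hV0.le (by positivity) (by field_simp; norm_num)
    (by
      refine (lintegral_mono fun x => ENNReal.ofReal_le_ofReal ?_).trans hV1
      exact truncMul_sq_le _ _ _ _)
  have e2 := hlarge (ν := ν) (N := N) (by linarith) hzm hz hK0.le hσ hKσ hNσ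
  have e3 := hz.measure_pi_exists_mul_gt_le hzm hη (κ := κ) hq hN hσ hNσ hint
    (by rw [← hκ']; linarith)
  rw [← hκ', ← hCm] at e3
  have e1' : 2 * Real.exp (N * ((1 / (2 * σ)) ^ 2 * V) - 1 / (2 * σ) * (A * (σ * p)))
      ≤ 2 * Real.exp (-(κ * p)) := by
    gcongr
    have : N * ((1 / (2 * σ)) ^ 2 * V) - 1 / (2 * σ) * (A * (σ * p)) = p * (V / 4 - A / 2) := by
      rw [hNσ]; field_simp; ring
    rw [this, hA]
    nlinarith [mul_pos hp0 hV0]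
  have hsub : multiplierEvent N a b D k η ∩
      {y | (A + (Cm * k + 2 + D + D') + (3 + Q)) * √(N * p)
        < |∑ i, (η (y i) * z (y i) - ∫ x, η x * z x ∂ν)|}
      ⊆ {y | A * (σ * p) ≤ |∑ i, (φ (y i) - ∫ x, φ x ∂ν)|} ∪
        ({y | D' * p ≤ ∑ i, largeSq K z (y i)} ∪
        {y | ∃ i, |η (y i)| ≤ √(N : ℝ) ∧ Cm * (σ * p) < |η (y i) * z (y i)|}) := by
    rintro y ⟨⟨hy1, hy2, hy3⟩, hy4⟩
    by_contra hcon
    simp only [Set.mem_union, not_or, Set.mem_ofPred_eq, not_exists, not_le, not_lt,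
      not_and] at hcon
    obtain ⟨hc1, hc2, hc3⟩ := hcon
    rw [Set.mem_ofPred_eq, ← not_le] at hy4
    apply hy4
    rw [hsq]
    have hdecomp : ∑ i, (η (y i) * z (y i) - ∫ x, η x * z x ∂ν)
        = ∑ i, (φ (y i) - ∫ x, φ x ∂ν) + ∑ i, (η (y i) * z (y i) - φ (y i))
          - N * ∫ x, (η x * z x - φ x) ∂ν := by
      rw [integral_sub hmi hφi]
      simp only [Finset.sum_sub_distrib, Finset.sum_const, Finset.card_univ, Fintype.card_fin,
        nsmul_eq_mul]
      ring
    -- Fewer than k indices have |η_i| > N^{1/b}; there the whole product is bounded by Cm σp.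
    -- Elsewhere the pointwise remainder bound applies, with |η_i|^a ≤ 1 when |η_i| ≤ 1.
    have hterm : ∀ i, |η (y i) * z (y i) - φ (y i)|
        ≤ Cm * (σ * p) * (if (N : ℝ) ^ (1 / b) < |η (y i)| then (1 : ℝ) else 0)
          + σ⁻¹ * (2 + (if 1 < |η (y i)| ∧ |η (y i)| ≤ (N : ℝ) ^ (1 / b)
              then |η (y i)| ^ a else 0)) + σ * largeSq K z (y i) := by
      intro i
      have hL0 := largeSq_nonneg K z (y i)
      by_cases hh : (N : ℝ) ^ (1 / b) < |η (y i)|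
      · have h1 : |η (y i) * z (y i) - φ (y i)| ≤ Cm * (σ * p) :=
          (abs_mul_sub_truncMul_le_abs_mul _ _ _ _).trans (hc3 i (hy1 i))
        rw [if_pos hh]
        have h2 : 0 ≤ σ⁻¹ * (2 + (if 1 < |η (y i)| ∧ |η (y i)| ≤ (N : ℝ) ^ (1 / b)
              then |η (y i)| ^ a else 0)) + σ * largeSq K z (y i) := by positivity
        linarith
      · refine (hψR (y i)).trans ?_
        rw [if_neg hh, mul_zero, zero_add]
        have h3 : |η (y i)| ^ a ≤ 1 + (if 1 < |η (y i)| ∧ |η (y i)| ≤ (N : ℝ) ^ (1 / b)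
              then |η (y i)| ^ a else 0) := by
          by_cases h1 : 1 < |η (y i)|
          · rw [if_pos ⟨h1, not_lt.1 hh⟩]; linarith
          · rw [if_neg (fun h => h1 h.1), add_zero]
            exact Real.rpow_le_one (abs_nonneg _) (not_lt.1 h1) (by linarith)
        have h4 : 1 + |η (y i)| ^ a ≤ 2 + (if 1 < |η (y i)| ∧ |η (y i)| ≤ (N : ℝ) ^ (1 / b)
              then |η (y i)| ^ a else 0) := by linarith
        exact add_le_add (mul_le_mul_of_nonneg_left h4 (by positivity)) le_rfl
    have hsum : |∑ i, (η (y i) * z (y i) - φ (y i))| ≤ (Cm * k + 2 + D + D') * (σ * p) := by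
      calc |∑ i, (η (y i) * z (y i) - φ (y i))|
          ≤ ∑ i, |η (y i) * z (y i) - φ (y i)| := Finset.abs_sum_le_sum_abs _ _
        _ ≤ _ := Finset.sum_le_sum fun i _ => hterm i
        _ = Cm * (σ * p) * (∑ i, (if (N : ℝ) ^ (1 / b) < |η (y i)| then (1 : ℝ) else 0))
          + σ⁻¹ * (2 * N + ∑ i, (if 1 < |η (y i)| ∧ |η (y i)| ≤ (N : ℝ) ^ (1 / b)
              then |η (y i)| ^ a else 0)) + σ * ∑ i, largeSq K z (y i) := by
          simp only [Finset.sum_add_distrib, ← Finset.mul_sum, Finset.sum_const, Finset.card_univ,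
            Fintype.card_fin, nsmul_eq_mul]
          ring
        _ ≤ Cm * (σ * p) * k + σ⁻¹ * (2 * N + D * N) + σ * (D' * p) := by gcongr
        _ = _ := by rw [hNσ]; field_simp; ring
    have hmean : |N * ∫ x, (η x * z x - φ x) ∂ν| ≤ (3 + Q) * (σ * p) := by
      rw [abs_mul, abs_of_pos hN0]
      calc N * |∫ x, (η x * z x - φ x) ∂ν| ≤ N * (σ⁻¹ * (3 + Q)) := by gcongr
        _ = _ := by rw [hNσ]; field_simp
    rw [hdecomp]
    calc _ ≤ |∑ i, (φ (y i) - ∫ x, φ x ∂ν) + ∑ i, (η (y i) * z (y i) - φ (y i))|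
          + |N * ∫ x, (η x * z x - φ x) ∂ν| := abs_sub _ _
      _ ≤ |∑ i, (φ (y i) - ∫ x, φ x ∂ν)| + |∑ i, (η (y i) * z (y i) - φ (y i))|
          + |N * ∫ x, (η x * z x - φ x) ∂ν| := by gcongr; exact abs_add_le _ _
      _ ≤ A * (σ * p) + (Cm * k + 2 + D + D') * (σ * p) + (3 + Q) * (σ * p) := by
          gcongr
      _ = _ := by ring
  refine (measure_mono hsub).trans ((measure_union_le _ _).trans ((add_le_add
    (e1.trans (ENNReal.ofReal_le_ofReal e1')) ((measure_union_le _ _).trans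
      (add_le_add e2 e3))).trans (le_of_eq ?_)))
  rw [← ENNReal.ofReal_add (by positivity) (by positivity),
    ← ENNReal.ofReal_add (by positivity) (by positivity)]
  congr 1
  ring

end IncrementTail

/-! ### The graded norm as a normalisation. -/

section GradedNorm

variable {Ω : Type*} [MeasurableSpace Ω] {μ : Measure Ω} {p : ℝ}

theorem gradedNorm_mono {p' : ℝ} (h : p ≤ p') (Z : Ω → ℝ) :
    gradedNorm μ p Z ≤ gradedNorm μ p' Z :=
  biSup_mono fun _ hr => ⟨hr.1, hr.2.trans h⟩

theorem eLpNorm_le_mul_gradedNorm {r : ℝ} (hr : 1 ≤ r) (hrp : r ≤ p) (Z : Ω → ℝ) :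
    eLpNorm Z (ENNReal.ofReal r) μ ≤ gradedNorm μ p Z * ENNReal.ofReal (√r) := by
  rw [← ENNReal.div_le_iff (by simp; linarith) (by simp)]
  exact le_biSup (fun r : ℝ => eLpNorm Z (ENNReal.ofReal r) μ / ENNReal.ofReal (√r))
    (⟨hr, hrp⟩ : r ∈ Set.Icc (1 : ℝ) p)

theorem gradedNorm_sub_le {f g : Ω → ℝ} (hf : Measurable f) (hg : Measurable g) :
    gradedNorm μ p (f - g) ≤ gradedNorm μ p f + gradedNorm μ p g := by
  refine iSup₂_le fun r hr => ?_
  calc eLpNorm (f - g) (ENNReal.ofReal r) μ / ENNReal.ofReal (√r)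
      ≤ (eLpNorm f (ENNReal.ofReal r) μ + eLpNorm g (ENNReal.ofReal r) μ)
          / ENNReal.ofReal (√r) := by
        gcongr
        exact eLpNorm_sub_le hf.aestronglyMeasurable hg.aestronglyMeasurable
          (by simpa using hr.1)
    _ = eLpNorm f (ENNReal.ofReal r) μ / ENNReal.ofReal (√r)
        + eLpNorm g (ENNReal.ofReal r) μ / ENNReal.ofReal (√r) := ENNReal.add_div
    _ ≤ _ := add_le_add
        (le_biSup (fun r : ℝ => eLpNorm f (ENNReal.ofReal r) μ / ENNReal.ofReal (√r)) hr)
        (le_biSup (fun r : ℝ => eLpNorm g (ENNReal.ofReal r) μ / ENNReal.ofReal (√r)) hr)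

theorem lintegral_abs_rpow_eq_eLpNorm_rpow {r : ℝ} (hr : 0 < r) (Z : Ω → ℝ) :
    ∫⁻ x, ENNReal.ofReal (|Z x| ^ r) ∂μ = eLpNorm Z (ENNReal.ofReal r) μ ^ r := by
  rw [eLpNorm_eq_lintegral_rpow_enorm_toReal (by simpa using hr) (by simp),
    ENNReal.toReal_ofReal hr.le, ← ENNReal.rpow_mul, one_div_mul_cancel hr.ne', ENNReal.rpow_one]
  refine lintegral_congr fun x => ?_
  rw [Real.enorm_eq_ofReal_abs, ENNReal.ofReal_rpow_of_nonneg (abs_nonneg _) hr.le]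

theorem lintegral_abs_div_rpow {c : ℝ} (hc : 0 < c) {r : ℝ} (hr : 0 < r) (Z : Ω → ℝ) :
    ∫⁻ x, ENNReal.ofReal (|Z x / c| ^ r) ∂μ
      = (eLpNorm Z (ENNReal.ofReal r) μ / ENNReal.ofReal c) ^ r := by
  rw [lintegral_abs_rpow_eq_eLpNorm_rpow hr]
  congr 1
  have : (fun x => Z x / c) = c⁻¹ • Z := by
    ext x; simp [div_eq_inv_mul]
  rw [this, eLpNorm_const_smul, Real.enorm_eq_ofReal_abs, abs_of_pos (by positivity),
    ENNReal.ofReal_inv_of_pos hc, mul_comm, div_eq_mul_inv]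

theorem momentsUpTo_div_gradedNorm {Z : Ω → ℝ} (h0 : gradedNorm μ p Z ≠ 0)
    (htop : gradedNorm μ p Z ≠ ∞) :
    MomentsUpTo μ p fun x => Z x / (gradedNorm μ p Z).toReal := by
  intro r hr hrp
  have hr0 : 0 < r := by linarith
  rw [lintegral_abs_div_rpow (ENNReal.toReal_pos h0 htop) hr0, ENNReal.ofReal_toReal htop]
  calc (eLpNorm Z (ENNReal.ofReal r) μ / gradedNorm μ p Z) ^ r
      ≤ ENNReal.ofReal (√r) ^ r := by
        gcongr
        rw [ENNReal.div_le_iff h0 htop, mul_comm]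
        exact eLpNorm_le_mul_gradedNorm hr hrp Z
    _ = _ := by
        rw [ENNReal.ofReal_rpow_of_nonneg (by positivity) hr0.le, Real.sqrt_eq_rpow,
          ← Real.rpow_mul hr0.le]
        congr 2; ring

end GradedNorm

/-! ### Homogeneous form of the deviation bound. -/

section MultiplierSum

variable {Ω : Type*} [MeasurableSpace Ω] {N : ℕ}

theorem MomentsUpTo.comp_snd {ν : Measure (ℝ × Ω)} {p : ℝ} {z : Ω → ℝ} (hzm : Measurable z)
    (hz : MomentsUpTo (ν.map Prod.snd) p z) : MomentsUpTo ν p fun x => z x.2 := by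
  intro r hr hrp
  have := hz r hr hrp
  rwa [lintegral_map (hzm.abs.pow_const r).ennreal_ofReal measurable_snd] at this

/-- The centered multiplier sum `∑ i, (ξ_i f(X_i) - 𝔼 ξ f(X))` on the sample space of `(ξ_i, X_i)`. -/
noncomputable def multiplierSum (ν : Measure (ℝ × Ω)) (y : Fin N → ℝ × Ω) (f : Ω → ℝ) : ℝ :=
  ∑ i, ((y i).1 * f (y i).2 - ∫ x, x.1 * f x.2 ∂ν)

theorem multiplierSum_sub {ν : Measure (ℝ × Ω)} {f g : Ω → ℝ}
    (hf : Integrable (fun x : ℝ × Ω => x.1 * f x.2) ν)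
    (hg : Integrable (fun x : ℝ × Ω => x.1 * g x.2) ν) (y : Fin N → ℝ × Ω) :
    multiplierSum ν y (f - g) = multiplierSum ν y f - multiplierSum ν y g := by
  have h : ∫ x, x.1 * (f - g) x.2 ∂ν = ∫ x, x.1 * f x.2 ∂ν - ∫ x, x.1 * g x.2 ∂ν := by
    rw [← integral_sub hf hg]
    exact integral_congr_ae (.of_forall fun x => by simp [mul_sub])
  unfold multiplierSum
  rw [h, ← Finset.sum_sub_distrib]
  exact Finset.sum_congr rfl fun i _ => by simp only [Pi.sub_apply]; ring

theorem multiplierSum_eq_zero_ae {ν : Measure (ℝ × Ω)} [IsProbabilityMeasure ν] {f : Ω → ℝ}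
    (h : ∀ᵐ x ∂ν, x.1 * f x.2 = 0) :
    ∀ᵐ y ∂(Measure.pi fun _ : Fin N => ν), multiplierSum ν y f = 0 := by
  have h1 : ∀ i : Fin N, ∀ᵐ y ∂(Measure.pi fun _ : Fin N => ν), (y i).1 * f (y i).2 = 0 := fun i =>
    (Measure.quasiMeasurePreserving_eval (fun _ : Fin N => ν) i).ae h
  filter_upwards [ae_all_iff.2 h1] with y hy
  unfold multiplierSum
  rw [integral_congr_ae h]
  simp [hy]

/-- Multipliers rescaled by `w ‖ξ‖_{L_q}`. -/
noncomputable def scaledMultiplier (ν : Measure (ℝ × Ω)) (q w : ℝ) (x : ℝ × Ω) : ℝ :=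
  x.1 / (w * (eLpNorm (Prod.fst : ℝ × Ω → ℝ) (ENNReal.ofReal q) ν).toReal)

theorem measurable_scaledMultiplier (ν : Measure (ℝ × Ω)) (q w : ℝ) :
    Measurable (scaledMultiplier ν q w) :=
  measurable_fst.div_const _

theorem lintegral_scaledMultiplier_le {ν : Measure (ℝ × Ω)} {q w : ℝ} (hq : 0 < q) (hw : 0 < w)
    (h0 : eLpNorm (Prod.fst : ℝ × Ω → ℝ) (ENNReal.ofReal q) ν ≠ 0)
    (htop : eLpNorm (Prod.fst : ℝ × Ω → ℝ) (ENNReal.ofReal q) ν ≠ ∞) :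
    ∫⁻ x, ENNReal.ofReal (|scaledMultiplier ν q w x| ^ q) ∂ν ≤ ENNReal.ofReal (w ^ (-q)) := by
  have hs := ENNReal.toReal_pos h0 htop
  unfold scaledMultiplier
  rw [lintegral_abs_div_rpow (by positivity) hq, ENNReal.ofReal_mul hw.le,
    ENNReal.ofReal_toReal htop, div_eq_mul_inv,
    ENNReal.mul_inv (Or.inr htop) (Or.inr h0), mul_comm (ENNReal.ofReal w)⁻¹, ← mul_assoc,
    ENNReal.mul_inv_cancel h0 htop, one_mul, ENNReal.inv_rpow,
    ENNReal.ofReal_rpow_of_nonneg hw.le hq.le, Real.rpow_neg hw.le,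
    ENNReal.ofReal_inv_of_pos (by positivity)]

/-- The normalised estimate rescaled by w‖ξ‖_{L_q} and by the graded norm. The good event is the
same for every g, which is what permits union bounds over chains. -/
theorem exists_measure_multiplierSum_gt_le {q b D κ : ℝ} {M k : ℕ} (hq : 2 < q)
    (hM : 2 ≤ M) (hMq : 2 * (M : ℝ) / (M - 1) ≤ q) (hD : 0 < D) (hκ : 0 < κ) :
    ∃ C p₀ : ℝ, 0 < C ∧ 1 ≤ p₀ ∧
    ∀ {Ω : Type*} [MeasurableSpace Ω] {ν : Measure (ℝ × Ω)} [IsProbabilityMeasure ν] {N : ℕ}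
      {w p : ℝ} {g : Ω → ℝ}, 1 ≤ N → 1 ≤ w → p₀ ≤ p → Measurable g →
      eLpNorm (Prod.fst : ℝ × Ω → ℝ) (ENNReal.ofReal q) ν ≠ 0 →
      eLpNorm (Prod.fst : ℝ × Ω → ℝ) (ENNReal.ofReal q) ν ≠ ∞ →
      (Measure.pi fun _ : Fin N => ν)
        (multiplierEvent N (2 * (M : ℝ) / (M - 1)) b D k (scaledMultiplier ν q w) ∩
        {y | ENNReal.ofReal (C * w * √(N * p)) *
            eLpNorm (Prod.fst : ℝ × Ω → ℝ) (ENNReal.ofReal q) ν * gradedNorm (ν.map Prod.snd) p g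
          < ‖multiplierSum ν y g‖ₑ})
        ≤ ENNReal.ofReal (5 * Real.exp (-(κ * p))) := by
  obtain ⟨C, p₀, hC, hp₀, key⟩ :=
    exists_measure_pi_multiplierEvent_inter_le (b := b) (k := k) hq hM hMq hD hκ
  refine ⟨C, p₀, hC, hp₀, ?_⟩
  intro Ω _ ν _ N w p g hN hw hp hg h0 htop
  have hN0 : (0 : ℝ) < N := by exact_mod_cast hN
  have hp0 : 0 < p := by linarith
  have hw0 : 0 < w := by linarith
  have hq0 : 0 < q := by linarith
  have hs := ENNReal.toReal_pos h0 htop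
  set s := eLpNorm (Prod.fst : ℝ × Ω → ℝ) (ENNReal.ofReal q) ν with hsdef
  set G := gradedNorm (ν.map Prod.snd) p g with hG
  rcases eq_or_ne G ∞ with hGt | hGt
  · have hne : ENNReal.ofReal (C * w * √(N * p)) * s ≠ 0 := by
      refine mul_ne_zero ?_ h0
      simp only [ne_eq, ENNReal.ofReal_eq_zero, not_le]
      positivity
    rw [hGt, ENNReal.mul_top hne]
    simp
  -- Normalisation is impossible here, but g vanishes almost everywhere and so does the sum.
  rcases eq_or_ne G 0 with hG0 | hG0
  · have h1 : eLpNorm g (ENNReal.ofReal 1) (ν.map Prod.snd) ≤ 0 := by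
      have := eLpNorm_le_mul_gradedNorm (μ := ν.map Prod.snd) le_rfl (hp₀.trans hp) g
      rwa [← hG, hG0, zero_mul] at this
    have h2 : g =ᵐ[ν.map Prod.snd] 0 := by
      refine (eLpNorm_eq_zero_iff hg.aestronglyMeasurable (by simp)).1 (le_antisymm h1 zero_le)
    have h3 : ∀ᵐ x ∂ν, x.1 * g x.2 = 0 := by
      filter_upwards [ae_of_ae_map measurable_snd.aemeasurable h2] with x hx
      simp only [Pi.zero_apply] at hx
      rw [hx, mul_zero]
    have h4 := multiplierSum_eq_zero_ae (N := N) h3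
    refine (measure_mono_null (Set.inter_subset_right.trans fun y hy => ?_)
      (ae_iff.1 h4)).le.trans zero_le
    intro hcon
    have hy' : _ < ‖multiplierSum ν y g‖ₑ := hy
    rw [hcon, enorm_zero] at hy'
    exact not_lt_zero hy'
  · have hGr := ENNReal.toReal_pos hG0 hGt
    have hη := lintegral_scaledMultiplier_le hq0 hw0 h0 htop
    have hw1 : w ^ (-q) ≤ 1 := Real.rpow_le_one_of_one_le_of_nonpos hw (by linarith)
    have hz := (momentsUpTo_div_gradedNorm hG0 hGt).comp_snd (hg.div_const _)
    refine (measure_mono (Set.inter_subset_inter_right _ fun y hy => ?_)).trans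
      (key hN (measurable_scaledMultiplier ν q w) ((hg.comp measurable_snd).div_const G.toReal) hp
        (hη.trans (ENNReal.ofReal_le_one.2 hw1)) hz)
    have hy' : ENNReal.ofReal (C * w * √(N * p)) * s * G < ‖multiplierSum ν y g‖ₑ := hy
    rw [← ENNReal.ofReal_toReal htop, ← ENNReal.ofReal_toReal hGt, ← ENNReal.ofReal_mul
      (by positivity), ← ENNReal.ofReal_mul (by positivity), Real.enorm_eq_ofReal_abs,
      ENNReal.ofReal_lt_ofReal_iff_of_nonneg (by positivity)] at hy'
    have hpt : ∀ x : ℝ × Ω, scaledMultiplier ν q w x * (g x.2 / G.toReal)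
        = x.1 * g x.2 / (w * s.toReal * G.toReal) := fun x => by
      unfold scaledMultiplier
      rw [← hsdef]
      field_simp
    have hsum : ∑ i, (scaledMultiplier ν q w (y i) * (g (y i).2 / G.toReal)
        - ∫ x, scaledMultiplier ν q w x * (g x.2 / G.toReal) ∂ν)
        = multiplierSum ν y g / (w * s.toReal * G.toReal) := by
      simp only [hpt]
      rw [integral_div, multiplierSum, Finset.sum_div]
      exact Finset.sum_congr rfl fun i _ => by ring
    change C * √(N * p) < |∑ i, (scaledMultiplier ν q w (y i) * (g (y i).2 / G.toReal)
        - ∫ x, scaledMultiplier ν q w x * (g x.2 / G.toReal) ∂ν)|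
    rw [hsum, abs_div, abs_of_pos (by positivity : 0 < w * s.toReal * G.toReal),
      lt_div_iff₀ (by positivity)]
    calc _ = C * w * √(N * p) * s.toReal * G.toReal := by ring
      _ < _ := hy'

end MultiplierSum

/-! ### Chaining along an admissible sequence. -/

section Chaining

open Filter Topology

theorem AdmissibleSeq.card_level_le {Ω : Type*} {F : Set (Ω → ℝ)} (A : AdmissibleSeq F) (s : ℕ) :
    (A.level s).card ≤ 2 ^ 2 ^ s := by
  rcases Nat.eq_zero_or_pos s with rfl | hs
  · rw [A.card_zero]; norm_num
  · exact A.card_le s hs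

/-- With p = u² 2^{s₀+k}, the number of links is at most e^p. Of the remaining e^{-2p}, one factor
gives the target probability and the other the summable weight (1/2)^{k+1}. -/
theorem two_pow_mul_exp_le {u : ℝ} (hu : 3 ≤ u) (s₀ k : ℕ) :
    (2 : ℝ) ^ 2 ^ (s₀ + k + 1) * 2 ^ 2 ^ (s₀ + k) * (5 * Real.exp (-(3 * (u ^ 2 * 2 ^ (s₀ + k)))))
      ≤ (1 / 2) ^ (k + 1) * Real.exp (-(u ^ 2 * 2 ^ s₀)) := by
  set p := u ^ 2 * 2 ^ (s₀ + k) with hp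
  have hu2 : 9 ≤ u ^ 2 := by nlinarith
  have h1 : (2 : ℝ) ^ 2 ^ (s₀ + k + 1) * 2 ^ 2 ^ (s₀ + k) ≤ Real.exp p := by
    rw [← pow_add, show 2 ^ (s₀ + k + 1) + 2 ^ (s₀ + k) = 3 * 2 ^ (s₀ + k) by ring]
    calc (2 : ℝ) ^ (3 * 2 ^ (s₀ + k)) ≤ (Real.exp 1) ^ (3 * 2 ^ (s₀ + k)) := by
          gcongr; linarith [Real.add_one_le_exp (1 : ℝ)]
      _ = Real.exp (3 * 2 ^ (s₀ + k)) := by rw [Real.exp_one_pow]; push_cast; rfl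
      _ ≤ Real.exp p := by
          apply Real.exp_le_exp.2
          rw [hp]; gcongr; linarith
  have h2 : Real.exp (-p) ≤ Real.exp (-(u ^ 2 * 2 ^ s₀)) := by
    apply Real.exp_le_exp.2
    rw [hp, neg_le_neg_iff]
    gcongr
    · norm_num
    · omega
  have h3 : 5 * Real.exp (-p) ≤ (1 / 2) ^ (k + 1) := by
    have h4 : ((k + 1 : ℕ) : ℝ) * 9 ≤ p := by
      have h5 : ((k + 1 : ℕ) : ℝ) ≤ 2 ^ k := by exact_mod_cast Nat.lt_two_pow_self
      have h6 : (2 : ℝ) ^ k ≤ 2 ^ (s₀ + k) := by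
        gcongr
        · norm_num
        · omega
      rw [hp]
      nlinarith [show (0 : ℝ) < 2 ^ k by positivity]
    have h7 : Real.exp (-9) ≤ 1 / 10 := by
      rw [Real.exp_neg, inv_eq_one_div]
      gcongr
      linarith [Real.add_one_le_exp (9 : ℝ)]
    calc 5 * Real.exp (-p) ≤ 5 ^ (k + 1) * Real.exp (((k + 1 : ℕ) : ℝ) * (-9)) := by
          gcongr
          · exact le_self_pow₀ (by norm_num) (by omega)
          · linarith
      _ = (5 * Real.exp (-9)) ^ (k + 1) := by rw [mul_pow, Real.exp_nat_mul]
      _ ≤ (1 / 2) ^ (k + 1) := by gcongr; linarith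
  calc _ ≤ Real.exp p * (5 * Real.exp (-(3 * p))) := by gcongr
    _ = 5 * Real.exp (-p) * Real.exp (-p) := by
        rw [mul_left_comm, ← Real.exp_add, mul_assoc, ← Real.exp_add]
        congr 2; ring
    _ ≤ _ := by gcongr

variable {Ω : Type*} [MeasurableSpace Ω] {N : ℕ} {ν : Measure (ℝ × Ω)}

/-- Telescoping from a 0 to f. A link is measured in the norm of its lower level k; the triangle
inequality through f, with monotonicity in the level, charges it to terms k and k + 1 of the
chaining sum. Hence the factor 2. -/
theorem enorm_multiplierSum_le_of_chain {y : Fin N → ℝ × Ω} {f : Ω → ℝ} {a : ℕ → Ω → ℝ}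
    (hf : Measurable f) (ha : ∀ k, Measurable (a k))
    (hint : ∀ k, Integrable (fun x : ℝ × Ω => x.1 * a k x.2) ν)
    (hlim : Tendsto (fun k => multiplierSum ν y (a k)) atTop (𝓝 (multiplierSum ν y f)))
    {B : ℝ≥0∞} {c : ℕ → ℝ≥0∞} {p : ℕ → ℝ} (hp : Monotone p) (hc : Monotone c)
    (hstart : ‖multiplierSum ν y (a 0)‖ₑ ≤ B * (c 0 * gradedNorm (ν.map Prod.snd) (p 0) (a 0)))
    (hincr : ∀ k, ‖multiplierSum ν y (a (k + 1) - a k)‖ₑ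
      ≤ B * (c k * gradedNorm (ν.map Prod.snd) (p k) (a (k + 1) - a k))) :
    ‖multiplierSum ν y f‖ₑ ≤ 2 * B * (∑' k, c k * gradedNorm (ν.map Prod.snd) (p k) (f - a k)
      + c 0 * gradedNorm (ν.map Prod.snd) (p 0) (a 0)) := by
  set g : ℕ → ℝ≥0∞ := fun k => c k * gradedNorm (ν.map Prod.snd) (p k) (f - a k) with hg
  set S := c 0 * gradedNorm (ν.map Prod.snd) (p 0) (a 0) with hS
  have hstep : ∀ k, ‖multiplierSum ν y (a (k + 1) - a k)‖ₑ ≤ B * (g k + g (k + 1)) := by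
    intro k
    refine (hincr k).trans ?_
    have h1 : a (k + 1) - a k = (f - a k) - (f - a (k + 1)) := by abel
    have h2 := gradedNorm_sub_le (μ := ν.map Prod.snd) (p := p k) (hf.sub (ha k))
      (hf.sub (ha (k + 1)))
    rw [← h1] at h2
    gcongr
    calc c k * gradedNorm (ν.map Prod.snd) (p k) (a (k + 1) - a k)
        ≤ c k * (gradedNorm (ν.map Prod.snd) (p k) (f - a k)
          + gradedNorm (ν.map Prod.snd) (p k) (f - a (k + 1))) := by gcongr
      _ ≤ g k + g (k + 1) := by
          rw [mul_add]
          gcongr ?_ + ?_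
          · exact le_rfl
          · exact mul_le_mul' (hc k.le_succ) (gradedNorm_mono (hp k.le_succ) _)
  have hpart : ∀ n, ‖multiplierSum ν y (a n)‖ₑ
      ≤ B * S + B * ∑ k ∈ Finset.range n, (g k + g (k + 1)) := by
    intro n
    induction n with
    | zero => simpa using hstart
    | succ n ih =>
      have h1 := multiplierSum_sub (hint (n + 1)) (hint n) y
      have h2 : multiplierSum ν y (a (n + 1))
          = multiplierSum ν y (a n) + multiplierSum ν y (a (n + 1) - a n) := by rw [h1]; ring
      rw [h2, Finset.sum_range_succ, mul_add, ← add_assoc]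
      exact (enorm_add_le _ _).trans (add_le_add ih (hstep n))
  have hbound : ∀ n, ‖multiplierSum ν y (a n)‖ₑ ≤ 2 * B * (∑' k, g k + S) := by
    intro n
    refine (hpart n).trans ?_
    have h1 : ∑ k ∈ Finset.range n, (g k + g (k + 1)) ≤ ∑' k, g k + ∑' k, g k := by
      rw [Finset.sum_add_distrib]
      refine add_le_add (ENNReal.sum_le_tsum _) ((ENNReal.sum_le_tsum _).trans ?_)
      exact ENNReal.tsum_comp_le_tsum_of_injective (add_left_injective 1) g
    calc B * S + B * ∑ k ∈ Finset.range n, (g k + g (k + 1))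
        ≤ (B * S + B * S) + B * (∑' k, g k + ∑' k, g k) := by
          gcongr
          exact le_self_add
      _ = _ := by ring
  exact le_of_tendsto ((continuous_enorm.tendsto _).comp hlim) (.of_forall hbound)

theorem eLpNorm_fst_mul_le {f : Ω → ℝ} (hf : Measurable f) :
    eLpNorm (fun x : ℝ × Ω => x.1 * f x.2) 1 ν
      ≤ eLpNorm (Prod.fst : ℝ × Ω → ℝ) 2 ν * eLpNorm f 2 (ν.map Prod.snd) := by
  rw [eLpNorm_map_measure hf.aestronglyMeasurable measurable_snd.aemeasurable]
  exact eLpNorm_smul_le_mul_eLpNorm (p := 2) (q := 2) (r := 1) (φ := (Prod.fst : ℝ × Ω → ℝ))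
    (f := f ∘ Prod.snd) (hf.comp measurable_snd).aestronglyMeasurable
    measurable_fst.aestronglyMeasurable

theorem integrable_fst_mul (hξ : MemLp (Prod.fst : ℝ × Ω → ℝ) 2 ν) {f : Ω → ℝ}
    (hf : Measurable f) (hf2 : eLpNorm f 2 (ν.map Prod.snd) ≠ ∞) :
    Integrable (fun x : ℝ × Ω => x.1 * f x.2) ν := by
  rw [← memLp_one_iff_integrable]
  refine ⟨(measurable_fst.mul (hf.comp measurable_snd)).aestronglyMeasurable, ?_⟩
  exact (eLpNorm_fst_mul_le hf).trans_lt (ENNReal.mul_lt_top hξ.2 hf2.lt_top)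

variable [IsProbabilityMeasure ν]

/-- Summable L₂ distances make ∑|f - a k| integrable, hence a k → f almost everywhere and at each
sample point; the means converge by Cauchy–Schwarz. -/
theorem ae_tendsto_multiplierSum (hξ : MemLp (Prod.fst : ℝ × Ω → ℝ) 2 ν) {f : Ω → ℝ}
    {a : ℕ → Ω → ℝ} (hf : Measurable f) (ha : ∀ k, Measurable (a k))
    (hf2 : eLpNorm f 2 (ν.map Prod.snd) ≠ ∞) (ha2 : ∀ k, eLpNorm (a k) 2 (ν.map Prod.snd) ≠ ∞)
    (hsum : ∑' k, eLpNorm (f - a k) 2 (ν.map Prod.snd) ≠ ∞) :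
    ∀ᵐ y ∂(Measure.pi fun _ : Fin N => ν),
      Tendsto (fun k => multiplierSum ν y (a k)) atTop (𝓝 (multiplierSum ν y f)) := by
  have hprob : IsProbabilityMeasure (ν.map (Prod.snd : ℝ × Ω → Ω)) :=
    Measure.isProbabilityMeasure_map measurable_snd.aemeasurable
  have h1 : ∫⁻ x, ∑' k, ‖(f - a k) x‖ₑ ∂(ν.map Prod.snd) ≠ ∞ := by
    rw [lintegral_tsum fun k => (hf.sub (ha k)).enorm.aemeasurable]
    refine ne_top_of_le_ne_top hsum (ENNReal.tsum_le_tsum fun k => ?_)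
    rw [← eLpNorm_one_eq_lintegral_enorm]
    exact eLpNorm_le_eLpNorm_of_exponent_le one_le_two (hf.sub (ha k)).aestronglyMeasurable
  have h2 : ∀ᵐ x ∂(ν.map Prod.snd), Tendsto (fun k => a k x) atTop (𝓝 (f x)) := by
    filter_upwards [ae_lt_top' (AEMeasurable.tsum
      fun k => (hf.sub (ha k)).enorm.aemeasurable) h1] with x hx
    have h3 := ENNReal.tendsto_atTop_zero_of_tsum_ne_top hx.ne
    rw [tendsto_iff_edist_tendsto_0]
    refine h3.congr fun k => ?_
    rw [edist_comm, edist_eq_enorm_sub, Pi.sub_apply]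
  have h3 : Tendsto (fun k => ∫ x, x.1 * a k x.2 ∂ν) atTop (𝓝 (∫ x, x.1 * f x.2 ∂ν)) := by
    refine tendsto_integral_of_L1 _ (integrable_fst_mul hξ hf hf2).aestronglyMeasurable
      (.of_forall fun k => integrable_fst_mul hξ (ha k) (ha2 k)) ?_
    have h4 := ENNReal.Tendsto.const_mul (ENNReal.tendsto_atTop_zero_of_tsum_ne_top hsum)
      (Or.inr hξ.2.ne)
    rw [mul_zero] at h4
    refine tendsto_of_tendsto_of_tendsto_of_le_of_le tendsto_const_nhds h4 (fun _ => zero_le)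
      fun k => ?_
    refine le_trans (le_of_eq ?_) (eLpNorm_fst_mul_le (hf.sub (ha k)))
    rw [eLpNorm_one_eq_lintegral_enorm]
    refine lintegral_congr fun x => ?_
    rw [Pi.sub_apply, mul_sub, ← enorm_neg, neg_sub]
  have h4 : ∀ i : Fin N, ∀ᵐ y ∂(Measure.pi fun _ : Fin N => ν),
      Tendsto (fun k => a k (y i).2) atTop (𝓝 (f (y i).2)) := fun i =>
    (Measure.quasiMeasurePreserving_eval (fun _ : Fin N => ν) i).ae
      (ae_of_ae_map measurable_snd.aemeasurable h2)
  filter_upwards [ae_all_iff.2 h4] with y hy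
  unfold multiplierSum
  exact tendsto_finsetSum _ fun i _ => ((hy i).const_mul _).sub h3

end Chaining

/-! ### Union bound over all links of a fixed admissible sequence. -/

section UniformBound

open Filter Topology

theorem ofReal_mul_sqrt_eq {c u : ℝ} (hc : 0 ≤ c) (hu : 0 ≤ u) (N m : ℕ) :
    ENNReal.ofReal (c * √(N * (u ^ 2 * 2 ^ m)))
      = ENNReal.ofReal (c * √N * u) * (2 : ℝ≥0∞) ^ ((m : ℝ) / 2) := by
  have h1 : (2 : ℝ≥0∞) ^ ((m : ℝ) / 2) = ENNReal.ofReal ((2 : ℝ) ^ ((m : ℝ) / 2)) := by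
    rw [← ENNReal.ofReal_rpow_of_pos two_pos, ENNReal.ofReal_ofNat]
  rw [h1, ← ENNReal.ofReal_mul (by positivity)]
  congr 1
  have h2 : √((2 : ℝ) ^ m) = (2 : ℝ) ^ ((m : ℝ) / 2) := by
    rw [Real.sqrt_eq_rpow, ← Real.rpow_natCast, ← Real.rpow_mul (by norm_num)]
    congr 1; ring
  rw [Real.sqrt_mul (by positivity), Real.sqrt_mul (by positivity), Real.sqrt_sq hu, h2]
  ring

theorem tsum_ofReal_half_pow_mul {c : ℝ} (hc : 0 ≤ c) :
    ∑' k : ℕ, ENNReal.ofReal ((1 / 2) ^ (k + 1) * c) = ENNReal.ofReal c := by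
  have hs : HasSum (fun k : ℕ => (1 / 2 : ℝ) ^ (k + 1) * c) c := by
    have h := (hasSum_geometric_two.mul_left (1 / 2 : ℝ)).mul_right c
    rw [show (1 / 2 : ℝ) * 2 * c = c by ring] at h
    simpa only [pow_succ'] using h
  rw [← ENNReal.ofReal_tsum_of_nonneg (fun k => by positivity) hs.summable, hs.tsum_eq]

theorem exists_measure_iSup_multiplierSum_gt_le {q : ℝ} (hq : 2 < q) :
    ∃ c₀ C : ℝ, 0 < c₀ ∧ 0 < C ∧
    ∀ {Ω : Type*} [MeasurableSpace Ω] {ν : Measure (ℝ × Ω)} [IsProbabilityMeasure ν] {N : ℕ}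
      {w u : ℝ} {F H : Set (Ω → ℝ)} (s₀ : ℕ) (A : AdmissibleSeq F)
      (π : ℕ → (Ω → ℝ) → (Ω → ℝ)), 1 ≤ N → c₀ < w → c₀ < u → (∀ f ∈ F, Measurable f) →
      H ⊆ F → H.Countable → (∀ s, ∀ f ∈ F, π s f ∈ A.level s) →
      eLpNorm (Prod.fst : ℝ × Ω → ℝ) (ENNReal.ofReal q) ν ≠ 0 →
      eLpNorm (Prod.fst : ℝ × Ω → ℝ) (ENNReal.ofReal q) ν ≠ ∞ →
      (Measure.pi fun _ : Fin N => ν) {y | ENNReal.ofReal (C * w * u) *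
          eLpNorm (Prod.fst : ℝ × Ω → ℝ) (ENNReal.ofReal q) ν *
          (chainingSum (ν.map Prod.snd) s₀ u F π + startingTerm (ν.map Prod.snd) s₀ u F π)
          < ⨆ f ∈ H, ‖(1 / √(N : ℝ)) * multiplierSum ν y f‖ₑ}
        ≤ ENNReal.ofReal (5 * (w ^ (-q) * (N : ℝ) ^ (-(q / 2 - 1)))
            + 2 * Real.exp (-(u ^ 2 * 2 ^ s₀))) := by
  have hq2 : 0 < q - 2 := by linarith
  -- M > q/(q-2) is equivalent to a = 2M/(M-1) < q, leaving room for b, taken as the midpoint of a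
  -- and q.
  set M : ℕ := ⌈q / (q - 2)⌉₊ + 2 with hMdef
  have hM2 : 2 ≤ M := by omega
  have hMR : (2 : ℝ) ≤ M := by exact_mod_cast hM2
  have hMq : 2 * (M : ℝ) / (M - 1) < q := by
    have h1 : q / (q - 2) < M := by
      rw [hMdef]; push_cast
      linarith [Nat.le_ceil (q / (q - 2))]
    rw [div_lt_iff₀ hq2] at h1
    rw [div_lt_iff₀ (by linarith)]
    linarith
  set a : ℝ := 2 * (M : ℝ) / (M - 1) with ha
  have ha0 : 0 < a := div_pos (by linarith) (by linarith)
  set b : ℝ := (a + q) / 2 with hb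
  obtain ⟨D, k₀, hD, hmult⟩ := exists_measure_compl_multiplierEvent_le (b := b) hq ha0
    (by rw [hb]; linarith) (by rw [hb]; linarith)
  obtain ⟨C, p₀, hC, hp₀, hincr⟩ := exists_measure_multiplierSum_gt_le (b := b) (k := k₀) hq hM2
    hMq.le hD (by norm_num : (0 : ℝ) < 3)
  -- The threshold gives w ≥ 3 > e, u ≥ 3 and u² ≥ p₀; the 2 comes from the telescoping bound.
  refine ⟨3 + p₀, 2 * C, by linarith, by positivity, ?_⟩
  intro Ω _ ν _ N w u F H s₀ A π hN hw hu hF hHF hH hπ h0 htop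
  have hN0 : (0 : ℝ) < N := by exact_mod_cast hN
  have hw3 : 3 ≤ w := by linarith
  have hu3 : 3 ≤ u := by linarith
  have hprob : IsProbabilityMeasure (ν.map (Prod.snd : ℝ × Ω → Ω)) :=
    Measure.isProbabilityMeasure_map measurable_snd.aemeasurable
  set μ := ν.map (Prod.snd : ℝ × Ω → Ω) with hμ
  set s := eLpNorm (Prod.fst : ℝ × Ω → ℝ) (ENNReal.ofReal q) ν with hs
  set P := Measure.pi fun _ : Fin N => ν with hP
  rcases eq_or_ne (chainingSum μ s₀ u F π + startingTerm μ s₀ u F π) ∞ with hval | hval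
  · have hne : ENNReal.ofReal (2 * C * w * u) * s ≠ 0 := by
      refine mul_ne_zero ?_ h0
      simp only [ne_eq, ENNReal.ofReal_eq_zero, not_le]
      positivity
    rw [hval, ENNReal.mul_top hne]
    simp
  obtain ⟨hchain, hstart⟩ := ENNReal.add_ne_top.1 hval
  set p : ℕ → ℝ := fun k => u ^ 2 * 2 ^ (s₀ + k) with hp
  set c : ℕ → ℝ≥0∞ := fun k => (2 : ℝ≥0∞) ^ (((s₀ + k : ℕ) : ℝ) / 2) with hc
  have hpp : ∀ k, p₀ ≤ p k := fun k => by
    have h1 : (1 : ℝ) ≤ 2 ^ (s₀ + k) := one_le_pow₀ (by norm_num)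
    calc p₀ ≤ u ^ 2 * 1 := by nlinarith
      _ ≤ u ^ 2 * 2 ^ (s₀ + k) := by gcongr
  have hp2 : ∀ k, 2 ≤ p k := fun k => by
    have h1 : (1 : ℝ) ≤ 2 ^ (s₀ + k) := one_le_pow₀ (by norm_num)
    calc (2 : ℝ) ≤ u ^ 2 * 1 := by nlinarith
      _ ≤ u ^ 2 * 2 ^ (s₀ + k) := by gcongr
  have hpmono : Monotone p := fun i j hij => by
    simp only [hp]
    gcongr
    norm_num
  have hcmono : Monotone c := fun i j hij => by
    simp only [hc]
    gcongr
    exact one_le_two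
  have hc1 : ∀ k, 1 ≤ c k := fun k => by
    simp only [hc]
    rw [← ENNReal.rpow_zero (x := 2)]
    exact ENNReal.rpow_le_rpow_of_exponent_le one_le_two (by positivity)
  set B : ℝ≥0∞ := ENNReal.ofReal (C * w * √(N : ℝ) * u) * s with hB
  have hBc : ∀ k, ENNReal.ofReal (C * w * √(N * p k)) * s = B * c k := fun k => by
    simp only [hp, hB, hc]
    rw [ofReal_mul_sqrt_eq (by positivity) (by positivity)]
    ring
  have hlev : ∀ m, ∀ g ∈ A.level m, Measurable g := fun m g hg => hF g (A.level_subset m hg)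
  set good := multiplierEvent N a b D k₀ (scaledMultiplier ν q w) with hgood
  set bad : ℕ → (Ω → ℝ) → Set (Fin N → ℝ × Ω) := fun k g =>
    good ∩ {y | ENNReal.ofReal (C * w * √(N * p k)) * s * gradedNorm μ (p k) g
      < ‖multiplierSum ν y g‖ₑ} with hbad
  have hbadle : ∀ k g, Measurable g → P (bad k g) ≤ ENNReal.ofReal (5 * Real.exp (-(3 * p k))) :=
    fun k g hg => hincr hN (by linarith) (hpp k) hg h0 htop
  have hbadle_of_not : ∀ y ∈ good, ∀ k g, y ∉ bad k g →
      ‖multiplierSum ν y g‖ₑ ≤ B * (c k * gradedNorm μ (p k) g) := by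
    intro y hy k g hyb
    rw [← mul_assoc, ← hBc]
    by_contra hcon
    exact hyb ⟨hy, not_le.1 hcon⟩
  -- square integrability of all functions in the chains
  have hξ2 : MemLp (Prod.fst : ℝ × Ω → ℝ) 2 ν := by
    have : MemLp (Prod.fst : ℝ × Ω → ℝ) (ENNReal.ofReal q) ν :=
      ⟨measurable_fst.aestronglyMeasurable, htop.lt_top⟩
    refine this.mono_exponent ?_
    rw [← ENNReal.ofReal_ofNat]
    exact ENNReal.ofReal_le_ofReal hq.le
  have hL2 : ∀ k g, eLpNorm g 2 μ ≤ gradedNorm μ (p k) g * ENNReal.ofReal (√2) := fun k g => by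
    have := eLpNorm_le_mul_gradedNorm (μ := μ) (r := 2) one_le_two (hp2 k) g
    rwa [ENNReal.ofReal_ofNat] at this
  have hsumf : ∀ f ∈ F, ∑' k, c k * gradedNorm μ (p k) (f - π (s₀ + k) f)
      ≤ chainingSum μ s₀ u F π := fun f hf =>
    le_biSup (fun f => ∑' k : ℕ, (2 : ℝ≥0∞) ^ (((s₀ + k : ℕ) : ℝ) / 2) *
      gradedNorm μ (u ^ 2 * 2 ^ (s₀ + k)) (f - π (s₀ + k) f)) hf
  have hstf : ∀ f ∈ F, c 0 * gradedNorm μ (p 0) (π (s₀ + 0) f) ≤ startingTerm μ s₀ u F π :=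
    fun f hf => mul_le_mul' le_rfl
      (le_biSup (fun f => gradedNorm μ (u ^ 2 * 2 ^ s₀) (π s₀ f)) hf)
  have hmeas : ∀ f ∈ F, ∀ k, Measurable (π (s₀ + k) f) := fun f hf k => hlev _ _ (hπ _ f hf)
  have hsum2 : ∀ f ∈ F, ∑' k, eLpNorm (f - π (s₀ + k) f) 2 μ ≠ ∞ := fun f hf => by
    refine ne_top_of_le_ne_top (ENNReal.mul_ne_top hchain
      (ENNReal.ofReal_ne_top (r := √2))) ?_
    refine le_trans ?_ (mul_le_mul' (hsumf f hf) le_rfl)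
    rw [← ENNReal.tsum_mul_right]
    refine ENNReal.tsum_le_tsum fun k => (hL2 k _).trans ?_
    gcongr
    exact le_mul_of_one_le_left zero_le (hc1 k)
  have hdiff2 : ∀ f ∈ F, ∀ k, eLpNorm (f - π (s₀ + k) f) 2 μ ≠ ∞ := fun f hf k =>
    ENNReal.ne_top_of_tsum_ne_top (hsum2 f hf) k
  have hstart2 : ∀ f ∈ F, eLpNorm (π (s₀ + 0) f) 2 μ ≠ ∞ := fun f hf => by
    refine ne_top_of_le_ne_top (ENNReal.mul_ne_top hstart
      (ENNReal.ofReal_ne_top (r := √2))) ((hL2 0 _).trans ?_)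
    refine mul_le_mul' (le_trans ?_ (hstf f hf)) le_rfl
    exact le_mul_of_one_le_left zero_le (hc1 0)
  have hf2 : ∀ f ∈ F, eLpNorm f 2 μ ≠ ∞ := fun f hf => by
    have h1 : f = (f - π (s₀ + 0) f) + π (s₀ + 0) f := by abel
    rw [h1]
    exact ((eLpNorm_add_le ((hF f hf).sub (hmeas f hf 0)).aestronglyMeasurable
      (hmeas f hf 0).aestronglyMeasurable one_le_two).trans_lt
      (ENNReal.add_lt_top.2 ⟨(hdiff2 f hf 0).lt_top, (hstart2 f hf).lt_top⟩)).ne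
  have hπ2 : ∀ f ∈ F, ∀ k, eLpNorm (π (s₀ + k) f) 2 μ ≠ ∞ := fun f hf k => by
    have h1 : π (s₀ + k) f = f - (f - π (s₀ + k) f) := by abel
    rw [h1]
    exact ((eLpNorm_sub_le (hF f hf).aestronglyMeasurable
      ((hF f hf).sub (hmeas f hf k)).aestronglyMeasurable one_le_two).trans_lt
      (ENNReal.add_lt_top.2 ⟨(hf2 f hf).lt_top, (hdiff2 f hf k).lt_top⟩)).ne
  -- Countability of H is what allows one null set to serve all f.
  have hlim : ∀ᵐ y ∂P, ∀ f ∈ H, Tendsto (fun k => multiplierSum ν y (π (s₀ + k) f)) atTop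
      (𝓝 (multiplierSum ν y f)) := by
    rw [ae_ball_iff hH]
    exact fun f hf => ae_tendsto_multiplierSum hξ2 (hF f (hHF hf)) (hmeas f (hHF hf))
      (hf2 f (hHF hf)) (hπ2 f (hHF hf)) (hsum2 f (hHF hf))
  -- outside the bad events the chaining bound holds
  set nul : Set (Fin N → ℝ × Ω) := {y | ¬ ∀ f ∈ H,
    Tendsto (fun k => multiplierSum ν y (π (s₀ + k) f)) atTop (𝓝 (multiplierSum ν y f))} with hnul
  have hnul0 : P nul = 0 := ae_iff.1 hlim
  set U₁ : Set (Fin N → ℝ × Ω) := ⋃ g ∈ A.level s₀, bad 0 g with hU₁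
  -- All pairs from consecutive levels are included, so the event does not depend on which f is
  -- being approximated.
  set U₂ : Set (Fin N → ℝ × Ω) :=
    ⋃ k : ℕ, ⋃ g ∈ A.level (s₀ + k + 1) ×ˢ A.level (s₀ + k), bad k (g.1 - g.2) with hU₂
  have hsub : {y | ENNReal.ofReal (2 * C * w * u) * s *
      (chainingSum μ s₀ u F π + startingTerm μ s₀ u F π)
      < ⨆ f ∈ H, ‖(1 / √(N : ℝ)) * multiplierSum ν y f‖ₑ} ⊆ goodᶜ ∪ (nul ∪ (U₁ ∪ U₂)) := by
    intro y hy
    by_contra hcon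
    simp only [Set.mem_union, not_or, Set.mem_compl_iff, not_not] at hcon
    obtain ⟨hyg, hyn, hy1, hy2⟩ := hcon
    have hyn' : ∀ f ∈ H, Tendsto (fun k => multiplierSum ν y (π (s₀ + k) f)) atTop
      (𝓝 (multiplierSum ν y f)) := not_not.1 hyn
    have hy' : _ < ⨆ f ∈ H, ‖(1 / √(N : ℝ)) * multiplierSum ν y f‖ₑ := hy
    refine absurd hy' (not_lt.2 (iSup₂_le fun f hf => ?_))
    have hfF := hHF hf
    have hy1' : y ∉ bad 0 (π (s₀ + 0) f) := fun h =>
      hy1 (Set.mem_biUnion (hπ s₀ f hfF) h)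
    have hy2' : ∀ k, y ∉ bad k (π (s₀ + (k + 1)) f - π (s₀ + k) f) := fun k h =>
      hy2 (Set.mem_iUnion.2 ⟨k, Set.mem_biUnion (x := (π (s₀ + (k + 1)) f, π (s₀ + k) f))
        (Finset.mem_coe.2 (Finset.mem_product.2 ⟨hπ _ f hfF, hπ _ f hfF⟩)) h⟩)
    have h1 := enorm_multiplierSum_le_of_chain (a := fun k => π (s₀ + k) f) (hF f hfF)
      (hmeas f hfF) (fun k => integrable_fst_mul hξ2 (hmeas f hfF k) (hπ2 f hfF k))
      (hyn' f hf) hpmono hcmono (hbadle_of_not y hyg 0 _ hy1')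
      (fun k => hbadle_of_not y hyg k _ (hy2' k))
    rw [enorm_mul, Real.enorm_eq_ofReal_abs, abs_of_nonneg (by positivity)]
    calc ENNReal.ofReal (1 / √(N : ℝ)) * ‖multiplierSum ν y f‖ₑ
        ≤ ENNReal.ofReal (1 / √(N : ℝ)) * (2 * B *
          (chainingSum μ s₀ u F π + startingTerm μ s₀ u F π)) := by
          gcongr
          refine h1.trans ?_
          gcongr
          · exact hsumf f hfF
          · exact hstf f hfF
      _ = _ := by
          have h2 : ENNReal.ofReal (2 * C * w * u) = ENNReal.ofReal (1 / √(N : ℝ)) *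
              (2 * ENNReal.ofReal (C * w * √(N : ℝ) * u)) := by
            rw [← ENNReal.ofReal_ofNat, ← ENNReal.ofReal_mul (by norm_num),
              ← ENNReal.ofReal_mul (by positivity)]
            congr 1
            have : √(N : ℝ) ≠ 0 := by positivity
            field_simp
          rw [h2, hB]
          ring
  have hcardpow : ∀ m, ((A.level m).card : ℝ) ≤ 2 ^ 2 ^ m := fun m => by
    exact_mod_cast A.card_level_le m
  have hP2 : ∀ k, P (⋃ g ∈ A.level (s₀ + k + 1) ×ˢ A.level (s₀ + k), bad k (g.1 - g.2))
      ≤ ENNReal.ofReal ((1 / 2) ^ (k + 1) * Real.exp (-(u ^ 2 * 2 ^ s₀))) := by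
    intro k
    refine (measure_biUnion_finset_le _ _).trans ?_
    refine (Finset.sum_le_card_nsmul _ _ (ENNReal.ofReal (5 * Real.exp (-(3 * p k))))
      fun g hg => ?_).trans ?_
    · rw [Finset.mem_product] at hg
      exact hbadle k _ ((hlev _ _ hg.1).sub (hlev _ _ hg.2))
    · rw [nsmul_eq_mul, ← ENNReal.ofReal_natCast, ← ENNReal.ofReal_mul (by positivity)]
      apply ENNReal.ofReal_le_ofReal
      refine le_trans ?_ (two_pow_mul_exp_le hu3 s₀ k)
      rw [Finset.card_product, Nat.cast_mul]
      gcongr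
      · exact hcardpow _
      · exact hcardpow _
  have hP1 : P U₁ ≤ ENNReal.ofReal (Real.exp (-(u ^ 2 * 2 ^ s₀))) := by
    refine (measure_biUnion_finset_le _ _).trans ?_
    refine (Finset.sum_le_card_nsmul _ _ (ENNReal.ofReal (5 * Real.exp (-(3 * p 0))))
      fun g hg => hbadle 0 g (hlev _ _ hg)).trans ?_
    rw [nsmul_eq_mul, ← ENNReal.ofReal_natCast, ← ENNReal.ofReal_mul (by positivity)]
    apply ENNReal.ofReal_le_ofReal
    have h1 := two_pow_mul_exp_le hu3 s₀ 0
    have h2 : (1 / 2 : ℝ) ^ (0 + 1) * Real.exp (-(u ^ 2 * 2 ^ s₀))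
        ≤ Real.exp (-(u ^ 2 * 2 ^ s₀)) := by
      have := Real.exp_pos (-(u ^ 2 * 2 ^ s₀))
      linarith
    refine le_trans ?_ (h1.trans h2)
    gcongr
    calc ((A.level s₀).card : ℝ) ≤ 2 ^ 2 ^ s₀ := hcardpow _
      _ ≤ _ := le_mul_of_one_le_left (by positivity) (one_le_pow₀ (by norm_num))
  have hP2' : P U₂ ≤ ENNReal.ofReal (Real.exp (-(u ^ 2 * 2 ^ s₀))) :=
    (measure_iUnion_le _).trans ((ENNReal.tsum_le_tsum hP2).trans
      (tsum_ofReal_half_pow_mul (Real.exp_pos _).le).le)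
  have hPg : P goodᶜ ≤ ENNReal.ofReal (5 * (w ^ (-q) * (N : ℝ) ^ (-(q / 2 - 1)))) :=
    hmult hN (measurable_scaledMultiplier ν q w)
      (by linarith [Real.exp_one_lt_d9]) (lintegral_scaledMultiplier_le (by linarith)
        (by linarith) h0 htop)
  have hw0 : 0 < w := by linarith
  calc _ ≤ P (goodᶜ ∪ (nul ∪ (U₁ ∪ U₂))) := measure_mono hsub
    _ ≤ P goodᶜ + (P nul + (P U₁ + P U₂)) :=
        (measure_union_le _ _).trans (add_le_add le_rfl ((measure_union_le _ _).trans
          (add_le_add le_rfl (measure_union_le _ _))))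
    _ ≤ ENNReal.ofReal (5 * (w ^ (-q) * (N : ℝ) ^ (-(q / 2 - 1))))
        + (0 + (ENNReal.ofReal (Real.exp (-(u ^ 2 * 2 ^ s₀)))
          + ENNReal.ofReal (Real.exp (-(u ^ 2 * 2 ^ s₀))))) := by
        gcongr
        exact hnul0.le
    _ = _ := by
        rw [zero_add, ← ENNReal.ofReal_add (by positivity) (by positivity),
          ← ENNReal.ofReal_add (by positivity) (by positivity)]
        congr 1; ring

end UniformBound

/-! ### Passing to the infimum over admissible sequences. -/

section LambdaTilde

open Filter Topology

variable {Ω : Type*} [MeasurableSpace Ω] {N : ℕ} {ν : Measure (ℝ × Ω)}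

theorem measurable_iSup_enorm_multiplierSum {H : Set (Ω → ℝ)} (hH : H.Countable)
    (hHm : ∀ f ∈ H, Measurable f) :
    Measurable fun y : Fin N → ℝ × Ω => ⨆ f ∈ H, ‖(1 / √(N : ℝ)) * multiplierSum ν y f‖ₑ := by
  refine Measurable.biSup H hH fun f hf => Measurable.enorm (Measurable.const_mul ?_ _)
  have := hHm f hf
  unfold multiplierSum
  fun_prop

/-- The infimum need not be attained, but the failure bound does not depend on the admissible
sequence. The strict failure event is an increasing union of events with slack 1/(n+1), each covered
by a near-optimal sequence. -/
theorem exists_measure_iSup_gt_lambdaTilde_le {q : ℝ} (hq : 2 < q) :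
    ∃ c₀ C : ℝ, 0 < c₀ ∧ 0 < C ∧
    ∀ {Ω : Type*} [MeasurableSpace Ω] {ν : Measure (ℝ × Ω)} [IsProbabilityMeasure ν] {N : ℕ}
      {w u : ℝ} {F H : Set (Ω → ℝ)} (s₀ : ℕ), 1 ≤ N → c₀ < w → c₀ < u → (∀ f ∈ F, Measurable f) →
      H ⊆ F → H.Countable → eLpNorm (Prod.fst : ℝ × Ω → ℝ) (ENNReal.ofReal q) ν ≠ ∞ →
      (Measure.pi fun _ : Fin N => ν) {y | ENNReal.ofReal (C * w * u) *
          eLpNorm (Prod.fst : ℝ × Ω → ℝ) (ENNReal.ofReal q) ν *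
          lambdaTilde (ν.map Prod.snd) s₀ u F
          < ⨆ f ∈ H, ‖(1 / √(N : ℝ)) * multiplierSum ν y f‖ₑ}
        ≤ ENNReal.ofReal (5 * (w ^ (-q) * (N : ℝ) ^ (-(q / 2 - 1)))
            + 2 * Real.exp (-(u ^ 2 * 2 ^ s₀))) := by
  obtain ⟨c₀, C, hc₀, hC, key⟩ := exists_measure_iSup_multiplierSum_gt_le hq
  refine ⟨c₀, C, hc₀, hC, ?_⟩
  intro Ω _ ν _ N w u F H s₀ hN hw hu hF hHF hH htop
  have hw0 : 0 < w := hc₀.trans hw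
  have hu0 : 0 < u := hc₀.trans hu
  set s := eLpNorm (Prod.fst : ℝ × Ω → ℝ) (ENNReal.ofReal q) ν with hs
  -- Here the bound is 0 even if the complexity is infinite, since 0 · ∞ = 0; the multipliers vanish
  -- almost surely, so the supremum is 0 as well.
  rcases eq_or_ne s 0 with h0 | h0
  · have h1 : (Prod.fst : ℝ × Ω → ℝ) =ᵐ[ν] 0 := by
      refine (eLpNorm_eq_zero_iff measurable_fst.aestronglyMeasurable ?_).1 h0
      simp only [ne_eq, ENNReal.ofReal_eq_zero, not_le]
      linarith
    have h2 : ∀ f : Ω → ℝ, ∀ᵐ x ∂ν, x.1 * f x.2 = 0 := fun f => by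
      filter_upwards [h1] with x hx
      rw [hx, Pi.zero_apply, zero_mul]
    have h3 : ∀ᵐ y ∂(Measure.pi fun _ : Fin N => ν), ∀ f ∈ H, multiplierSum ν y f = 0 :=
      (ae_ball_iff hH).2 fun f _ => multiplierSum_eq_zero_ae (h2 f)
    refine (measure_mono_null (fun y hy => ?_) (ae_iff.1 h3)).le.trans zero_le
    intro hcon
    have hy' : _ < ⨆ f ∈ H, ‖(1 / √(N : ℝ)) * multiplierSum ν y f‖ₑ := hy
    refine absurd hy' (not_lt.2 (iSup₂_le fun f hf => ?_))
    rw [hcon f hf, mul_zero, enorm_zero]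
    exact zero_le
  set lam := lambdaTilde (ν.map Prod.snd) s₀ u F with hlam
  have hC0 : ENNReal.ofReal (C * w * u) ≠ 0 := by
    simp only [ne_eq, ENNReal.ofReal_eq_zero, not_le]
    positivity
  have hK0 : ENNReal.ofReal (C * w * u) * s ≠ 0 := mul_ne_zero hC0 h0
  have hKt : ENNReal.ofReal (C * w * u) * s ≠ ∞ := ENNReal.mul_ne_top ENNReal.ofReal_ne_top htop
  rcases eq_or_ne lam ∞ with hl | hl
  · rw [hl, ENNReal.mul_top hK0]
    simp
  set E : ℕ → Set (Fin N → ℝ × Ω) := fun n => {y | ENNReal.ofReal (C * w * u) * s *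
    (lam + ((n + 1 : ℕ) : ℝ≥0∞)⁻¹) < ⨆ f ∈ H, ‖(1 / √(N : ℝ)) * multiplierSum ν y f‖ₑ} with hE
  have hsub : {y | ENNReal.ofReal (C * w * u) * s * lam
      < ⨆ f ∈ H, ‖(1 / √(N : ℝ)) * multiplierSum ν y f‖ₑ} ⊆ ⋃ n, E n := by
    intro y hy
    have h1 : Tendsto (fun n : ℕ => ENNReal.ofReal (C * w * u) * s *
        (lam + ((n + 1 : ℕ) : ℝ≥0∞)⁻¹)) atTop (𝓝 (ENNReal.ofReal (C * w * u) * s * (lam + 0))) :=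
      ENNReal.Tendsto.const_mul (tendsto_const_nhds.add
        ((tendsto_add_atTop_iff_nat 1).2 ENNReal.tendsto_inv_nat_nhds_zero)) (Or.inr hKt)
    rw [add_zero] at h1
    obtain ⟨n, hn⟩ := (h1.eventually_lt_const hy).exists
    exact Set.mem_iUnion.2 ⟨n, hn⟩
  have hmono : Monotone E := fun i j hij y hy => by
    have hy' : ENNReal.ofReal (C * w * u) * s * (lam + ((i + 1 : ℕ) : ℝ≥0∞)⁻¹)
      < ⨆ f ∈ H, ‖(1 / √(N : ℝ)) * multiplierSum ν y f‖ₑ := hy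
    refine lt_of_le_of_lt ?_ hy'
    gcongr
  refine (measure_mono hsub).trans ?_
  rw [hmono.measure_iUnion]
  refine iSup_le fun n => ?_
  have hlt : lam < lam + ((n + 1 : ℕ) : ℝ≥0∞)⁻¹ :=
    ENNReal.lt_add_right hl (ENNReal.inv_ne_zero.2 (ENNReal.natCast_ne_top _))
  rw [hlam] at hlt
  conv_lhs at hlt => unfold lambdaTilde
  simp only [iInf_lt_iff] at hlt
  obtain ⟨A, π, hπ, hval⟩ := hlt
  refine (measure_mono fun y hy => ?_).trans
    (key s₀ A π hN hw hu hF hHF hH (fun s f hf => (hπ s f hf).1) h0 htop)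
  have hy' : ENNReal.ofReal (C * w * u) * s * (lam + ((n + 1 : ℕ) : ℝ≥0∞)⁻¹)
    < ⨆ f ∈ H, ‖(1 / √(N : ℝ)) * multiplierSum ν y f‖ₑ := hy
  refine lt_of_le_of_lt ?_ hy'
  rw [← hlam] at hval
  gcongr

end LambdaTilde

/-! ### Transfer to the original probability space. -/

theorem mainTheorem2 (q : ℝ) (hq : 2 < q) :
    ∃ c₀ c₁ c₂ c₃ : ℝ, 0 < c₀ ∧ 0 < c₁ ∧ 0 < c₂ ∧ 0 < c₃ ∧
      ∀ (Ω : Type*) [MeasurableSpace Ω] (μ : Measure Ω)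
        (S : Type*) [MeasurableSpace S] (P : Measure S) [IsProbabilityMeasure P]
        (F : Set (Ω → ℝ)) (_ : ∀ f ∈ F, Measurable f)
        (X : S → Ω) (ξ : S → ℝ)
        (_ : HasLaw X μ P) (_ : MemLp ξ (ENNReal.ofReal q) P)
        (N : ℕ) (_ : 2 ≤ N) (Xs : Fin N → S → Ω) (ξs : Fin N → S → ℝ)
        (_ : iIndepFun (fun i ω => (ξs i ω, Xs i ω)) P)
        (_ : ∀ i, IdentDistrib (fun ω => (ξs i ω, Xs i ω)) (fun ω => (ξ ω, X ω)) P P)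
        (s₀ : ℕ) (w u : ℝ) (_ : c₀ < w) (_ : c₀ < u)
        (H : Set (Ω → ℝ)) (_ : H ⊆ F) (_ : H.Countable),
        1 - c₁ * w ^ (-q) * (N : ℝ) ^ (-(q / 2 - 1)) * Real.log N ^ q
            - 2 * Real.exp (-c₂ * u ^ 2 * 2 ^ s₀)
          ≤ P.real {ω | ⨆ f ∈ H,
              ‖(1 / √(N : ℝ)) * ∑ i, (ξs i ω * f (Xs i ω) - ∫ ω', ξ ω' * f (X ω') ∂P)‖ₑ
                ≤ ENNReal.ofReal (c₃ * w * u) * eLpNorm ξ (ENNReal.ofReal q) P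
                    * lambdaTilde μ s₀ u F} := by
  obtain ⟨c₀, C, hc₀, hC, key⟩ := exists_measure_iSup_gt_lambdaTilde_le hq
  have hlog2 : 0 < Real.log 2 := Real.log_pos one_lt_two
  -- Dividing by log^q 2 lets the factor log^q N, for N ≥ 2, be inserted into the failure
  -- probability.
  refine ⟨c₀, 5 / Real.log 2 ^ q, 1, C, hc₀, by positivity, one_pos, hC, ?_⟩
  intro Ω _ μ S _ P _ F hF X ξ hX hξ N hN Xs ξs hindep hid s₀ w u hw hu H hHF hH
  have hw0 : 0 < w := hc₀.trans hw
  have hN2 : (2 : ℝ) ≤ N := by exact_mod_cast hN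
  have hY : AEMeasurable (fun ω => (ξ ω, X ω)) P := (hid ⟨0, by omega⟩).aemeasurable_snd
  set ν : Measure (ℝ × Ω) := P.map fun ω => (ξ ω, X ω) with hν
  have hνprob : IsProbabilityMeasure ν := Measure.isProbabilityMeasure_map hY
  have hμ : ν.map Prod.snd = μ := by
    rw [hν, AEMeasurable.map_map_of_aemeasurable measurable_snd.aemeasurable hY, ← hX.map_eq]
    rfl
  have hnorm : eLpNorm (Prod.fst : ℝ × Ω → ℝ) (ENNReal.ofReal q) ν
      = eLpNorm ξ (ENNReal.ofReal q) P := by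
    rw [hν, eLpNorm_map_measure measurable_fst.aestronglyMeasurable hY]
    rfl
  have hint : ∀ f : Ω → ℝ, Measurable f → ∫ ω, ξ ω * f (X ω) ∂P = ∫ x, x.1 * f x.2 ∂ν :=
    fun f hf => (integral_map hY
      (measurable_fst.mul (hf.comp measurable_snd)).aestronglyMeasurable).symm
  set Y : S → Fin N → ℝ × Ω := fun ω i => (ξs i ω, Xs i ω) with hYdef
  have hYm : AEMeasurable Y P := aemeasurable_pi_lambda _ fun i => (hid i).aemeasurable_fst
  -- Independence and identical distribution of the pairs reduce everything to the product measure.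
  have hlaw : P.map Y = Measure.pi fun _ : Fin N => ν := by
    rw [hYdef, (iIndepFun_iff_map_fun_eq_pi_map fun i => (hid i).aemeasurable_fst).1 hindep]
    congr 1
    ext1 i
    exact (hid i).map_eq
  set R := ENNReal.ofReal (C * w * u) * eLpNorm ξ (ENNReal.ofReal q) P * lambdaTilde μ s₀ u F
    with hR
  set B : Set (Fin N → ℝ × Ω) :=
    {y | ⨆ f ∈ H, ‖(1 / √(N : ℝ)) * multiplierSum ν y f‖ₑ ≤ R} with hB
  have hBm : MeasurableSet B := measurableSet_le
    (measurable_iSup_enorm_multiplierSum hH fun f hf => hF f (hHF hf)) measurable_const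
  have hset : {ω | ⨆ f ∈ H,
      ‖(1 / √(N : ℝ)) * ∑ i, (ξs i ω * f (Xs i ω) - ∫ ω', ξ ω' * f (X ω') ∂P)‖ₑ ≤ R}
      = Y ⁻¹' B := by
    ext ω
    have h1 : ⨆ f ∈ H,
        ‖(1 / √(N : ℝ)) * ∑ i, (ξs i ω * f (Xs i ω) - ∫ ω', ξ ω' * f (X ω') ∂P)‖ₑ
        = ⨆ f ∈ H, ‖(1 / √(N : ℝ)) * multiplierSum ν (Y ω) f‖ₑ :=
      iSup_congr fun f => iSup_congr fun hf => by rw [hint f (hF f (hHF hf))]; rfl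
    simp only [Set.mem_ofPred_eq, Set.mem_preimage, hB, h1]
  have hcompl : Bᶜ = {y | R < ⨆ f ∈ H, ‖(1 / √(N : ℝ)) * multiplierSum ν y f‖ₑ} := by
    ext y
    simp only [hB, Set.mem_compl_iff, Set.mem_ofPred_eq, not_le]
  have hfail : P (Y ⁻¹' B)ᶜ ≤ ENNReal.ofReal (5 * (w ^ (-q) * (N : ℝ) ^ (-(q / 2 - 1)))
      + 2 * Real.exp (-(u ^ 2 * 2 ^ s₀))) := by
    have h1 := key (ν := ν) (N := N) s₀ (by omega) hw hu hF hHF hH (by rw [hnorm]; exact hξ.2.ne)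
    rw [hnorm, hμ, ← hR, ← hcompl] at h1
    rwa [← Set.preimage_compl, ← Measure.map_apply_of_aemeasurable hYm hBm.compl, hlaw]
  have hnull : NullMeasurableSet (Y ⁻¹' B) P := hYm.nullMeasurableSet_preimage hBm
  have hreal : 1 - (5 * (w ^ (-q) * (N : ℝ) ^ (-(q / 2 - 1)))
      + 2 * Real.exp (-(u ^ 2 * 2 ^ s₀))) ≤ P.real (Y ⁻¹' B) := by
    have h1 : P.real (Y ⁻¹' B)ᶜ ≤ 5 * (w ^ (-q) * (N : ℝ) ^ (-(q / 2 - 1)))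
        + 2 * Real.exp (-(u ^ 2 * 2 ^ s₀)) :=
      ENNReal.toReal_le_of_le_ofReal (by positivity) hfail
    rw [probReal_compl_eq_one_sub₀ hnull] at h1
    linarith
  rw [hset]
  refine le_trans ?_ hreal
  have hlogN : 1 ≤ Real.log N ^ q / Real.log 2 ^ q := by
    rw [one_le_div (by positivity)]
    exact Real.rpow_le_rpow hlog2.le (Real.log_le_log two_pos hN2) (by linarith)
  have hx : 0 ≤ w ^ (-q) * (N : ℝ) ^ (-(q / 2 - 1)) := by positivity
  have h1 : 5 / Real.log 2 ^ q * w ^ (-q) * (N : ℝ) ^ (-(q / 2 - 1)) * Real.log N ^ q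
      = 5 * (w ^ (-q) * (N : ℝ) ^ (-(q / 2 - 1))) * (Real.log N ^ q / Real.log 2 ^ q) := by ring
  have h2 : -1 * u ^ 2 * 2 ^ s₀ = -(u ^ 2 * 2 ^ s₀) := by ring
  rw [h1, h2]
  have h3 := le_mul_of_one_le_right (mul_nonneg (by norm_num : (0 : ℝ) ≤ 5) hx) hlogN
  linarith
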